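/- Let $\psi:\mathbb{R}\to\mathbb{R}$ be increasing and differentiable with $\psi'(t)\neq 0$ for all $t$ and $\psi(t)\to\pm\infty$ as $t\to\pm\infty$. Let $L^2_\psi(\mathbb{R})$ be the space of measurable $v:\mathbb{R}\to\mathbb{R}$ with $\|v\|_{L^2_\psi}^2=\int_{\mathbb{R}}|v|^2\psi'\,dt<\infty$, with scalar product $(v,w)_\psi=\int_{\mathbb{R}} v\,w\,\psi'\,dt$, and put $\tilde v=v\circ\psi^{-1}$ and $\mathcal F(f)(\xi)=\int_{\mathbb{R}} f(s)e^{-i\xi s}\,ds$ (extended to $L^2(\mathbb{R})$). For $\delta>0$ let $n$ be the integer with $n-1\le\delta<n$. For test functions $w=\varphi\circ\psi$, $\varphi\in C_0^\infty(\mathbb{R})$, let $$D^{\delta,\psi}_t w(t)=\Big(\tfrac{1}{\psi'(t)}\tfrac{d}{dt}\Big)^n\frac{1}{\Gamma(n-\delta)}\int_{-\infty}^t\psi'(z)(\psi(t)-\psi(z))^{n-\delta-1}w(z)\,dz,$$ $${}_tD^{\delta,\psi} w(t)=\Big(-\tfrac{1}{\psi'(t)}\tfrac{d}{dt}\Big)^n\frac{1}{\Gamma(n-\delta)}\int_t^{\infty}\psi'(z)(\psi(z)-\psi(t))^{n-\delta-1}w(z)\,dz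 .$$ For $v\in L^2_\psi(\mathbb{R})$ the derivatives are understood in the distribution sense: $D^{\delta,\psi}_tv\in L^2_\psi(\mathbb{R})$ means that there is $g\in L^2_\psi(\mathbb{R})$ with $(g,w)_\psi=(v,{}_tD^{\delta,\psi}w)_\psi$ for all test functions $w$, and then $D^{\delta,\psi}_tv=g$; likewise ${}_tD^{\delta,\psi}v=h$ if $h\in L^2_\psi(\mathbb{R})$ and $(h,w)_\psi=(v,D_t^{\delta,\psi}w)_\psi$ for all test functions $w$. Define the semi-norms $$|v|_L=\|D^{\delta,\psi}_tv\|_{L^2_\psi},\qquad |v|_R=\|{}_tD^{\delta,\psi}v\|_{L^2_\psi},\qquad |v|_c=\big|(D^{\delta,\psi}_tv,\,{}_tD^{\delta,\psi}v)_\psi\big|^{1/2},\qquad |v|_H=\big\||\xi|^\delta\mathcal F(\tilde v)\big\|_{L^2(\mathbb{R})},$$ and the norms $\|v\|_X=(\|v\|_{L^2_\psi}^2+|v|_X^2)^{1/2}$ for $X\in\{L,R,c,H\}$. Let ${}^{L}H^{\delta,\psi}(\mathbb{R})$, ${}^{R}H^{\delta,\psi}(\mathbb{R})$ and ${}^{c}H^{\delta,\psi}(\mathbb{R})$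 be the sets of $v\in L^2_\psi(\mathbb{R})$ for which, respectively, the left derivative, the right derivative, and both derivatives lie in $L^2_\psi(\mathbb{R})$, and let $H^{\delta,\psi}(\mathbb{R})$ be the set of $v\in L^2_\psi(\mathbb{R})$ with $(1+|\xi|^\delta)\mathcal F(\tilde v)\in L^2(\mathbb{R})$. Let $\delta>0$ with $\delta\ne n-1/2$ for all $n\in\mathbb{N}$. Then, for every such $\psi$, the spaces ${}^{L}H^{\delta,\psi}(\mathbb{R})$, ${}^{R}H^{\delta,\psi}(\mathbb{R})$, ${}^{c}H^{\delta,\psi}(\mathbb{R})$ and $H^{\delta,\psi}(\mathbb{R})$ are equal, with equivalent semi-norms and norms: there are constants $c,C>0$ depending only on $\delta$ such that $c\,|v|_H\le|v|_X\le C\,|v|_H$ and $c\,\|v\|_H\le\|v\|_X\le C\,\|v\|_H$ for all $X\in\{L,R,c\}$ and all $v$ in this space. -/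

import Mathlib

open MeasureTheory Set Filter FourierTransform
open scoped ContDiff

noncomputable section

namespace PsiFrac

/-- Admissible scaling functions on the whole line: increasing, differentiable, with nowhere
vanishing derivative, and tending to `±∞` at `±∞` (so that `ψ⁻¹` is defined on all of `ℝ`). -/
structure IsScaling (ψ : ℝ → ℝ) : Prop where
  strictMono : StrictMono ψ
  differentiable : Differentiable ℝ ψ
  deriv_ne_zero : ∀ t, deriv ψ t ≠ 0
  tendsto_atTop : Tendsto ψ atTop atTop
  tendsto_atBot : Tendsto ψ atBot atBot

/-- The function `ṽ = v ∘ ψ⁻¹`. -/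
def pull (ψ v : ℝ → ℝ) : ℝ → ℝ := fun s => v (Function.invFun ψ s)

/-! ### The weighted space `L²_ψ(ℝ)` of real-valued functions -/

/-- `v ∈ L²_ψ(ℝ)`: `v` is (Lebesgue) measurable and `∫ |v|² ψ' dt < ∞`. -/
def MemL2 (ψ v : ℝ → ℝ) : Prop :=
  AEStronglyMeasurable v volume ∧ Integrable (fun t => |v t| ^ 2 * deriv ψ t) volume

/-- The scalar product `(v, w) = ∫ v w ψ' dt` of `L²_ψ(ℝ)`. -/
def inner2 (ψ v w : ℝ → ℝ) : ℝ := ∫ t, v t * w t * deriv ψ t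

/-- The norm of `L²_ψ(ℝ)`. -/
def norm2 (ψ v : ℝ → ℝ) : ℝ := Real.sqrt (inner2 ψ v v)

/-! ### `ψ`-Riemann–Liouville operators on the whole line -/

/-- Left `ψ`-fractional integral of order `α`, with lower limit `-∞`. -/
def leftInt (ψ : ℝ → ℝ) (α : ℝ) (v : ℝ → ℝ) : ℝ → ℝ := fun t =>
  1 / Real.Gamma α * ∫ z in Iio t, deriv ψ z * (ψ t - ψ z) ^ (α - 1) * v z

/-- Right `ψ`-fractional integral of order `α`, with upper limit `+∞`. -/
def rightInt (ψ : ℝ → ℝ) (α : ℝ) (v : ℝ → ℝ) : ℝ → ℝ := fun t =>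
  1 / Real.Gamma α * ∫ z in Ioi t, deriv ψ z * (ψ z - ψ t) ^ (α - 1) * v z

/-- The operator `(1/ψ') d/dt`. -/
def scaledDeriv (ψ f : ℝ → ℝ) : ℝ → ℝ := fun t => 1 / deriv ψ t * deriv f t

/-- The integer `n ≥ 1` with `n - 1 ≤ δ < n` (for `δ ≥ 0`). -/
def order (δ : ℝ) : ℕ := ⌊δ⌋₊ + 1

/-- Left `ψ`-Riemann–Liouville derivative `((1/ψ') d/dt)ⁿ I^{n-δ}` (pointwise definition). -/
def leftRL (ψ : ℝ → ℝ) (δ : ℝ) (v : ℝ → ℝ) : ℝ → ℝ :=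
  (scaledDeriv ψ)^[order δ] (leftInt ψ (order δ - δ) v)

/-- Right `ψ`-Riemann–Liouville derivative `(-(1/ψ') d/dt)ⁿ I^{n-δ}` (pointwise definition). -/
def rightRL (ψ : ℝ → ℝ) (δ : ℝ) (v : ℝ → ℝ) : ℝ → ℝ :=
  (fun f t => -scaledDeriv ψ f t)^[order δ] (rightInt ψ (order δ - δ) v)

/-! ### Fractional derivatives of `L²_ψ` functions, in the distribution sense -/

/-- Test functions: `w = φ ∘ ψ` with `φ ∈ C₀^∞(ℝ)`, i.e. compactly supported functions that are
infinitely differentiable for `(1/ψ') d/dt`. For smooth `ψ` these are exactly the functions in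
`C₀^∞(ℝ)`; for a `ψ` that is only differentiable they are the class on which the pointwise
fractional derivatives of every order exist. -/
def IsTest (ψ w : ℝ → ℝ) : Prop :=
  ContDiff ℝ ∞ (pull ψ w) ∧ HasCompactSupport (pull ψ w)

/-- `g ∈ L²_ψ(ℝ)` is the left `ψ`-fractional derivative of order `δ` of `v`:
`(g, w) = (v, ₜD w)` for all test functions `w`. -/
def IsLeftDeriv (ψ : ℝ → ℝ) (δ : ℝ) (v g : ℝ → ℝ) : Prop :=
  MemL2 ψ g ∧ ∀ w, IsTest ψ w → inner2 ψ g w = inner2 ψ v (rightRL ψ δ w)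

/-- `g ∈ L²_ψ(ℝ)` is the right `ψ`-fractional derivative of order `δ` of `v`:
`(g, w) = (v, D w)` for all test functions `w`. -/
def IsRightDeriv (ψ : ℝ → ℝ) (δ : ℝ) (v g : ℝ → ℝ) : Prop :=
  MemL2 ψ g ∧ ∀ w, IsTest ψ w → inner2 ψ g w = inner2 ψ v (leftRL ψ δ w)

open Classical in
/-- The left `ψ`-fractional derivative (unique up to null sets; `0` if there is none in
`L²_ψ(ℝ)`). -/
def leftD (ψ : ℝ → ℝ) (δ : ℝ) (v : ℝ → ℝ) : ℝ → ℝ :=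
  if h : ∃ g, IsLeftDeriv ψ δ v g then h.choose else 0

open Classical in
/-- The right `ψ`-fractional derivative (unique up to null sets; `0` if there is none in
`L²_ψ(ℝ)`). -/
def rightD (ψ : ℝ → ℝ) (δ : ℝ) (v : ℝ → ℝ) : ℝ → ℝ :=
  if h : ∃ g, IsRightDeriv ψ δ v g then h.choose else 0

/-! ### The left, right and mixed spaces -/

/-- The left space: `v ∈ L²_ψ(ℝ)` whose left derivative belongs to `L²_ψ(ℝ)`. -/
def leftSpace (ψ : ℝ → ℝ) (δ : ℝ) : Set (ℝ → ℝ) :=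
  {v | MemL2 ψ v ∧ ∃ g, IsLeftDeriv ψ δ v g}

def leftSemi (ψ : ℝ → ℝ) (δ : ℝ) (v : ℝ → ℝ) : ℝ := norm2 ψ (leftD ψ δ v)

def leftNorm (ψ : ℝ → ℝ) (δ : ℝ) (v : ℝ → ℝ) : ℝ :=
  Real.sqrt (norm2 ψ v ^ 2 + leftSemi ψ δ v ^ 2)

/-- The right space: `v ∈ L²_ψ(ℝ)` whose right derivative belongs to `L²_ψ(ℝ)`. -/
def rightSpace (ψ : ℝ → ℝ) (δ : ℝ) : Set (ℝ → ℝ) :=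
  {v | MemL2 ψ v ∧ ∃ g, IsRightDeriv ψ δ v g}

def rightSemi (ψ : ℝ → ℝ) (δ : ℝ) (v : ℝ → ℝ) : ℝ := norm2 ψ (rightD ψ δ v)

def rightNorm (ψ : ℝ → ℝ) (δ : ℝ) (v : ℝ → ℝ) : ℝ :=
  Real.sqrt (norm2 ψ v ^ 2 + rightSemi ψ δ v ^ 2)

/-- The mixed space: `v ∈ L²_ψ(ℝ)` for which the `L²_ψ(ℝ)` scalar product of the left and the right
derivative is defined, i.e. both derivatives are elements of `L²_ψ(ℝ)`. -/
def mixedSpace (ψ : ℝ → ℝ) (δ : ℝ) : Set (ℝ → ℝ) :=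
  {v | MemL2 ψ v ∧ (∃ g, IsLeftDeriv ψ δ v g) ∧ ∃ h, IsRightDeriv ψ δ v h}

def mixedSemi (ψ : ℝ → ℝ) (δ : ℝ) (v : ℝ → ℝ) : ℝ :=
  Real.sqrt |inner2 ψ (leftD ψ δ v) (rightD ψ δ v)|

def mixedNorm (ψ : ℝ → ℝ) (δ : ℝ) (v : ℝ → ℝ) : ℝ :=
  Real.sqrt (norm2 ψ v ^ 2 + mixedSemi ψ δ v ^ 2)

/-! ### The Fourier-defined space -/

open Classical in
/-- The `L²` Fourier transform in the convention `∫ f(s) e^{-iξs} ds`: Mathlib's transform, whose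
kernel is `e^{-2πiξs}`, evaluated at `ξ / (2π)`. -/
def fourierL2 (f : ℝ → ℂ) : ℝ → ℂ := fun ξ =>
  if h : MemLp f 2 volume then (𝓕 (h.toLp f) : Lp ℂ 2 (volume : Measure ℝ)) (ξ / (2 * Real.pi))
  else 0

/-- `𝓕(ṽ)`. -/
def fourierPull (ψ v : ℝ → ℝ) : ℝ → ℂ := fourierL2 (fun s => (pull ψ v s : ℂ))

/-- `H^{δ,ψ}(ℝ)`: `v ∈ L²_ψ(ℝ)` with `(1 + |ξ|^δ) 𝓕(ṽ)(ξ) ∈ L²(ℝ)`. -/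
def fourierSpace (ψ : ℝ → ℝ) (δ : ℝ) : Set (ℝ → ℝ) :=
  {v | MemL2 ψ v ∧ MemLp (fun ξ : ℝ => ((1 + |ξ| ^ δ : ℝ) : ℂ) * fourierPull ψ v ξ) 2 volume}

def fourierSemi (ψ : ℝ → ℝ) (δ : ℝ) (v : ℝ → ℝ) : ℝ :=
  Real.sqrt (∫ ξ : ℝ, (|ξ| ^ δ * ‖fourierPull ψ v ξ‖) ^ 2)

def fourierNorm (ψ : ℝ → ℝ) (δ : ℝ) (v : ℝ → ℝ) : ℝ :=
  Real.sqrt (norm2 ψ v ^ 2 + fourierSemi ψ δ v ^ 2)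

end PsiFrac

end

/-!
The substitution `s = ψ(t)` carries `L²_ψ(ℝ)` isometrically onto `L²(ℝ)` and turns the
`ψ`-fractional operators into the classical Riemann–Liouville operators on the line. On test
functions these are the Fourier multipliers `(±2πiη)^δ`: the kernel of the fractional integral is
not integrable, but after damping by `e^{-ε|y|}` its Fourier transform is Euler's integral, and
`ε → 0` recovers the multiplier. By duality the weak derivatives of an `L²` function are given by
the same multipliers, so the left and the right derivative have the same `L²` norm. Their scalar
product is governed by `Re ((2πiη)^{2δ}) = cos(πδ) (2π|η|)^{2δ}`, and `cos(πδ)` vanishes exactly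
at the half-integers.
-/

namespace PsiFrac

open Topology ComplexConjugate
open scoped SchwartzMap Convolution

section EulerIntegral

variable {a : ℝ}

theorem integrableOn_rpow_mul_exp_neg_mul (ha : 0 < a) {r : ℝ} (hr : 0 < r) :
    IntegrableOn (fun t : ℝ => t ^ (a - 1) * Real.exp (-r * t)) (Ioi 0) := by
  simpa using integrableOn_rpow_mul_exp_neg_mul_rpow (s := a - 1) (p := 1) (by linarith) one_pos hr

theorem norm_rpow_mul_cexp_neg_mul (z : ℂ) {t : ℝ} (ht : 0 ≤ t) :
    ‖((t ^ (a - 1) : ℝ) : ℂ) * Complex.exp (-z * t)‖ = t ^ (a - 1) * Real.exp (-z.re * t) := by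
  rw [norm_mul, Complex.norm_real, Real.norm_of_nonneg (by positivity), Complex.norm_exp]
  simp

theorem integrableOn_rpow_mul_cexp_neg_mul (ha : 0 < a) {z : ℂ} (hz : 0 < z.re) :
    IntegrableOn (fun t : ℝ => ((t ^ (a - 1) : ℝ) : ℂ) * Complex.exp (-z * t)) (Ioi 0) := by
  refine (integrableOn_rpow_mul_exp_neg_mul ha hz).mono' (by fun_prop) ?_
  filter_upwards [ae_restrict_mem measurableSet_Ioi] with t ht
  exact (norm_rpow_mul_cexp_neg_mul z (mem_Ioi.1 ht).le).le

theorem differentiableAt_integral_rpow_mul_cexp_neg_mul (ha : 0 < a) {z : ℂ} (hz : 0 < z.re) :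
    DifferentiableAt ℂ
      (fun z => ∫ t in Ioi (0 : ℝ), ((t ^ (a - 1) : ℝ) : ℂ) * Complex.exp (-z * t)) z := by
  have nhds_half : {w : ℂ | z.re / 2 < w.re} ∈ 𝓝 z :=
    (isOpen_lt continuous_const Complex.continuous_re).mem_nhds (half_lt_self hz)
  refine (hasDerivAt_integral_of_dominated_loc_of_deriv_le (μ := volume.restrict (Ioi (0 : ℝ)))
    (F := fun z t => ((t ^ (a - 1) : ℝ) : ℂ) * Complex.exp (-z * t))
    (F' := fun z t => ((t ^ (a - 1) : ℝ) : ℂ) * (Complex.exp (-z * t) * (-t)))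
    (bound := fun t => t ^ (a + 1 - 1) * Real.exp (-(z.re / 2) * t)) nhds_half
    (Eventually.of_forall fun w => by fun_prop) (integrableOn_rpow_mul_cexp_neg_mul ha hz)
    (by fun_prop) ?_ (integrableOn_rpow_mul_exp_neg_mul (by linarith) (half_pos hz))
    (Eventually.of_forall fun t w _ => ?_)).2.differentiableAt
  · filter_upwards [ae_restrict_mem measurableSet_Ioi] with t (ht : 0 < t) w (hw : z.re / 2 < w.re)
    calc ‖((t ^ (a - 1) : ℝ) : ℂ) * (Complex.exp (-w * t) * (-t))‖
        = t ^ (a - 1) * Real.exp (-w.re * t) * t := by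
          rw [← mul_assoc, norm_mul, norm_rpow_mul_cexp_neg_mul w ht.le, norm_neg,
            Complex.norm_real, Real.norm_of_nonneg ht.le]
      _ ≤ t ^ (a - 1) * Real.exp (-(z.re / 2) * t) * t := by gcongr
      _ = t ^ (a + 1 - 1) * Real.exp (-(z.re / 2) * t) := by
          rw [show a + 1 - 1 = a - 1 + 1 by ring, Real.rpow_add_one ht.ne']
          ring
  · have : HasDerivAt (fun z : ℂ => -z * (t : ℂ)) (-(t : ℂ)) w := by
      simpa using (hasDerivAt_id w).neg.mul_const (t : ℂ)
    exact this.cexp.const_mul _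

theorem integral_rpow_mul_cexp_neg_mul_Ioi_ofReal (ha : 0 < a) {r : ℝ} (hr : 0 < r) :
    ∫ t in Ioi (0 : ℝ), ((t ^ (a - 1) : ℝ) : ℂ) * Complex.exp (-r * t)
      = r ^ (-a : ℂ) * Real.Gamma a := by
  have cast_integrand : ∀ t : ℝ, ((t ^ (a - 1) : ℝ) : ℂ) * Complex.exp (-r * t)
      = ((t ^ (a - 1) * Real.exp (-(r * t)) : ℝ) : ℂ) := fun t => by simp
  simp only [cast_integrand]
  rw [integral_complex_ofReal, Real.integral_rpow_mul_exp_neg_mul_Ioi ha hr, one_div,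
    Real.inv_rpow hr.le, ← Real.rpow_neg hr.le, Complex.ofReal_mul, Complex.ofReal_cpow hr.le,
    Complex.ofReal_neg]

-- Both sides are holomorphic in the right half-plane and agree on the positive reals.
theorem integral_rpow_mul_cexp_neg_mul_Ioi (ha : 0 < a) {z : ℂ} (hz : 0 < z.re) :
    ∫ t in Ioi (0 : ℝ), ((t ^ (a - 1) : ℝ) : ℂ) * Complex.exp (-z * t)
      = z ^ (-a : ℂ) * Real.Gamma a := by
  have isOpen_re : IsOpen {z : ℂ | 0 < z.re} := isOpen_lt continuous_const Complex.continuous_re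
  have eq_frequently : ∃ᶠ z : ℂ in 𝓝[≠] ((1 : ℝ) : ℂ),
      ∫ t in Ioi (0 : ℝ), ((t ^ (a - 1) : ℝ) : ℂ) * Complex.exp (-z * t)
        = z ^ (-a : ℂ) * Real.Gamma a := by
    have tendsto_ofReal : Tendsto Complex.ofReal (𝓝[≠] 1) (𝓝[≠] ((1 : ℝ) : ℂ)) :=
      Complex.continuous_ofReal.continuousWithinAt.tendsto_nhdsWithin
        fun r hr => Complex.ofReal_injective.ne hr
    refine tendsto_ofReal.frequently (Eventually.frequently ?_)
    filter_upwards [nhdsWithin_le_nhds (lt_mem_nhds one_pos)] with r hr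
    exact integral_rpow_mul_cexp_neg_mul_Ioi_ofReal ha hr
  have differentiableOn_lhs : DifferentiableOn ℂ
      (fun z => ∫ t in Ioi (0 : ℝ), ((t ^ (a - 1) : ℝ) : ℂ) * Complex.exp (-z * t))
      {z | 0 < z.re} := fun w hw =>
    (differentiableAt_integral_rpow_mul_cexp_neg_mul ha hw).differentiableWithinAt
  have differentiableOn_rhs : DifferentiableOn ℂ
      (fun z : ℂ => z ^ (-a : ℂ) * Real.Gamma a) {z | 0 < z.re} := fun w hw =>
    ((differentiableAt_id.cpow_const (Or.inl hw)).mul_const _).differentiableWithinAt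
  exact (differentiableOn_lhs.analyticOnNhd isOpen_re).eqOn_of_preconnected_of_frequently_eq
    (differentiableOn_rhs.analyticOnNhd isOpen_re) (convex_halfSpace_re_gt 0).isPreconnected
    (z₀ := ((1 : ℝ) : ℂ)) (by simp) eq_frequently hz

end EulerIntegral

section FourierInversion

variable {V F : Type*} [NormedAddCommGroup V] [InnerProductSpace ℝ V] [FiniteDimensional ℝ V]
  [MeasurableSpace V] [BorelSpace V] [NormedAddCommGroup F]

theorem ae_eq_of_integral_schwartz_smul_eq [NormedSpace ℂ F] [CompleteSpace F] {f g : V → F}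
    (hf : LocallyIntegrable f) (hg : LocallyIntegrable g)
    (h : ∀ φ : 𝓢(V, ℂ), ∫ x, φ x • f x = ∫ x, φ x • g x) : f =ᵐ[volume] g := by
  refine ae_eq_of_integral_contDiff_smul_eq hf hg fun φ hφ hφc => ?_
  have hφc' : HasCompactSupport (Complex.ofRealCLM ∘ φ) := hφc.comp_left rfl
  have hφ' : ContDiff ℝ ∞ (Complex.ofRealCLM ∘ φ) := by fun_prop
  simpa using h (hφc'.toSchwartzMap hφ')

theorem continuous_fourierInv_of_integrable [NormedSpace ℂ F] {f : V → F} (hf : Integrable f) :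
    Continuous (𝓕⁻ f) := by
  rw [← Real.Lp.fourierTransformInv_toLp (memLp_one_iff_integrable.2 hf)]
  exact BoundedContinuousFunction.continuous _

theorem integral_fourierInv_smul_eq_of_integrable [NormedSpace ℂ F] [CompleteSpace F]
    (φ : 𝓢(V, ℂ)) {f : V → F} (hf : Integrable f) :
    ∫ x, 𝓕⁻ φ x • f x = ∫ x, φ x • 𝓕⁻ f x := by
  have flip_neg : (-innerₗ V).flip = -innerₗ V := by ext; simp [real_inner_comm]
  have h := VectorFourier.integral_fourierIntegral_smul_eq_flip (L := -innerₗ V)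
    Real.continuous_fourierChar (by simp only [LinearMap.neg_apply, innerₗ_apply_apply]; fun_prop)
    (φ.integrable (μ := volume)) hf
  rw [flip_neg] at h
  rw [SchwartzMap.fourierInv_coe]
  exact h

theorem ae_eq_zero_of_fourierInv_eq_zero [NormedSpace ℂ F] [CompleteSpace F] {f : V → F}
    (hf : Integrable f) (h : ∀ x, 𝓕⁻ f x = 0) : f =ᵐ[volume] 0 := by
  refine ae_eq_of_integral_schwartz_smul_eq hf.locallyIntegrable
    (integrable_zero V F volume).locallyIntegrable fun φ => ?_
  simpa [h] using integral_fourierInv_smul_eq_of_integrable (𝓕 φ) hf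

theorem fourierInv_toLp_ae_eq [InnerProductSpace ℂ F] [CompleteSpace F] {f : V → F}
    (hf : Integrable f) (hf₂ : MemLp f 2) :
    (𝓕⁻ (hf₂.toLp f) : Lp F 2 (volume : Measure V)) =ᵐ[volume] 𝓕⁻ f := by
  refine ae_eq_of_integral_schwartz_smul_eq ((Lp.memLp _).locallyIntegrable one_le_two)
    (continuous_fourierInv_of_integrable hf).locallyIntegrable fun φ => ?_
  have h := congrArg (fun T => T φ) (Lp.fourierInv_toTemperedDistribution_eq (hf₂.toLp f))
  simp only [TemperedDistribution.fourierInv_apply, Lp.toTemperedDistribution_apply] at h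
  rw [← h, ← integral_fourierInv_smul_eq_of_integrable φ hf]
  refine integral_congr_ae ?_
  filter_upwards [hf₂.coeFn_toLp] with x hx
  rw [hx]

theorem memLp_two_fourierInv [InnerProductSpace ℂ F] [CompleteSpace F] {f : V → F}
    (hf : Integrable f) (hf₂ : MemLp f 2) : MemLp (𝓕⁻ f) 2 :=
  (Lp.memLp _).ae_eq (fourierInv_toLp_ae_eq hf hf₂)

theorem fourier_toLp_fourierInv [InnerProductSpace ℂ F] [CompleteSpace F] {f : V → F}
    (hf : Integrable f) (hf₂ : MemLp f 2) (h : MemLp (𝓕⁻ f) 2) :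
    𝓕 (h.toLp (𝓕⁻ f)) = hf₂.toLp f := by
  have : h.toLp (𝓕⁻ f) = 𝓕⁻ (hf₂.toLp f) := by
    refine Lp.ext ?_
    filter_upwards [h.coeFn_toLp, fourierInv_toLp_ae_eq hf hf₂] with x h₁ h₂
    rw [h₁, h₂]
  rw [this, FourierTransform.fourier_fourierInv_eq]

theorem integral_inner_fourierInv [InnerProductSpace ℂ F] [CompleteSpace F] {m : V → F}
    (hm : Integrable m) (hm₂ : MemLp m 2) (f : Lp F 2 (volume : Measure V)) :
    ∫ x, inner ℂ (𝓕⁻ m x) (f x) = ∫ ξ, inner ℂ (m ξ) ((𝓕 f : Lp F 2 (volume : Measure V)) ξ) := by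
  have hm_inv := memLp_two_fourierInv hm hm₂
  have plancherel := Lp.inner_fourier_eq (hm_inv.toLp (𝓕⁻ m)) f
  rw [fourier_toLp_fourierInv hm hm₂, L2.inner_def, L2.inner_def] at plancherel
  calc ∫ x, inner ℂ (𝓕⁻ m x) (f x) = ∫ x, inner ℂ (hm_inv.toLp (𝓕⁻ m) x) (f x) :=
        integral_congr_ae (hm_inv.coeFn_toLp.mono fun x hx => by simp only [hx])
    _ = ∫ ξ, inner ℂ (hm₂.toLp m ξ) ((𝓕 f : Lp F 2 (volume : Measure V)) ξ) := plancherel.symm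
    _ = _ := integral_congr_ae (hm₂.coeFn_toLp.mono fun ξ hξ => by simp only [hξ])

end FourierInversion

section Convolution

variable {E F G : Type*} [NormedAddCommGroup E] [NormedSpace ℝ E] [NormedAddCommGroup F]
  [NormedSpace ℝ F] [NormedAddCommGroup G] [NormedSpace ℝ G]

theorem hasCompactSupport_iteratedDeriv (n : ℕ) {f : ℝ → E} (hf : HasCompactSupport f) :
    HasCompactSupport (iteratedDeriv n f) := by
  induction n with
  | zero => simpa using hf
  | succ n ih => rw [iteratedDeriv_succ]; exact ih.deriv

theorem iteratedDeriv_clm_comp (L : E →L[ℝ] F) {n : ℕ} {f : ℝ → E} (hf : ContDiff ℝ n f) :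
    iteratedDeriv n (L ∘ f) = L ∘ iteratedDeriv n f := by
  funext x
  simp [iteratedDeriv, L.iteratedFDeriv_comp_left hf.contDiffAt le_rfl]

theorem iteratedDeriv_convolution (L : E →L[ℝ] F →L[ℝ] G) {k : ℝ → E} (hk : LocallyIntegrable k)
    {n : ℕ} {f : ℝ → F} (hf : ContDiff ℝ n f) (hfc : HasCompactSupport f) :
    iteratedDeriv n (k ⋆[L] f) = k ⋆[L] iteratedDeriv n f := by
  induction n generalizing f with
  | zero => simp
  | succ n ih =>
    have hf' : ContDiff ℝ n (deriv f) := (contDiff_succ_iff_deriv.1 hf).2.2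
    have deriv_conv : deriv (k ⋆[L] f) = k ⋆[L] deriv f := funext fun x =>
      (hfc.hasDerivAt_convolution_right L hk (hf.of_le (by norm_cast; lia)) x).deriv
    rw [iteratedDeriv_succ', iteratedDeriv_succ', deriv_conv, ih hf' hfc.deriv]

theorem tendsto_convolution_exp_neg_mul (L : E →L[ℝ] F →L[ℝ] G) {k : ℝ → E}
    (hk : LocallyIntegrable k) {f : ℝ → F} (hf : Continuous f) (hfc : HasCompactSupport f) (s : ℝ) :
    Tendsto (fun ε : ℝ => ((fun y => Real.exp (-ε * |y|) • k y) ⋆[L] f) s) (𝓝[>] 0)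
      (𝓝 ((k ⋆[L] f) s)) := by
  have conv_exists := hfc.convolutionExists_right L hk hf s
  refine tendsto_integral_filter_of_dominated_convergence (fun y => ‖L (k y) (f (s - y))‖) ?_ ?_
    conv_exists.norm ?_
  · refine Eventually.of_forall fun ε => ?_
    simp only [map_smul, smul_apply]
    exact AEStronglyMeasurable.smul (by fun_prop) conv_exists.aestronglyMeasurable
  · filter_upwards [self_mem_nhdsWithin] with ε (hε : 0 < ε)
    refine Eventually.of_forall fun y => ?_
    rw [map_smul, smul_apply, norm_smul, Real.norm_of_nonneg (by positivity)]
    refine mul_le_of_le_one_left (norm_nonneg _) (Real.exp_le_one_iff.2 ?_)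
    rw [neg_mul]
    exact neg_nonpos.2 (by positivity)
  · refine Eventually.of_forall fun y => ?_
    have h : Continuous fun ε : ℝ => L (Real.exp (-ε * |y|) • k y) (f (s - y)) := by
      simp only [map_smul, smul_apply]
      fun_prop
    simpa using (h.tendsto 0).mono_left nhdsWithin_le_nhds

end Convolution

/-- The kernel `|y|^{α-1} / Γ(α)` of the Riemann–Liouville integral of order `α`, carried by the
half-line `σ y > 0`: convolving with it integrates over the past for `σ = 1` and over the future
for `σ = -1`. -/
noncomputable def kernel (σ : ℤˣ) (α y : ℝ) : ℝ :=
  (Ioi (0 : ℝ)).indicator (fun t => t ^ (α - 1) / Real.Gamma α) (σ • y)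

/-- The Riemann–Liouville derivative of order `δ` on the line without scaling function, left for
`σ = 1` and right for `σ = -1`. -/
noncomputable def lineRL {E : Type*} [NormedAddCommGroup E] [NormedSpace ℝ E] (σ : ℤˣ) (δ : ℝ)
    (φ : ℝ → E) : ℝ → E :=
  σ ^ order δ • iteratedDeriv (order δ)
    (kernel σ (order δ - δ) ⋆[ContinuousLinearMap.lsmul ℝ ℝ] φ)

/-- The Fourier multiplier `(2πiση)^δ` of the Riemann–Liouville derivative `lineRL σ δ`. -/
noncomputable def symbol (σ : ℤˣ) (δ η : ℝ) : ℂ :=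
  (2 * Real.pi * Complex.I * (σ • η : ℝ)) ^ (δ : ℂ)

theorem order_sub_pos (δ : ℝ) : 0 < order δ - δ := by
  have := Nat.lt_floor_add_one δ
  simpa [order] using this

section Kernel

variable (σ : ℤˣ) {α : ℝ}

theorem integrable_exp_neg_mul_kernel (hα : 0 < α) {ε : ℝ} (hε : 0 < ε) :
    Integrable (fun y => Real.exp (-ε * |y|) • kernel σ α y) := by
  have integrable_left : Integrable (fun y => Real.exp (-ε * |y|) • kernel 1 α y) := by
    refine ((integrable_indicator_iff measurableSet_Ioi).2
      ((integrableOn_rpow_mul_exp_neg_mul hα hε).const_mul (Real.Gamma α)⁻¹)).congr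
      (Eventually.of_forall fun y => ?_)
    by_cases hy : 0 < y
    · simp only [kernel, indicator, mem_Ioi, hy, one_smul, if_true, abs_of_pos hy, smul_eq_mul]
      ring
    · simp [kernel, hy]
  rcases Int.units_eq_one_or σ with rfl | rfl
  · exact integrable_left
  · simpa [kernel] using integrable_left.comp_neg

theorem locallyIntegrable_kernel (hα : 0 < α) : LocallyIntegrable (kernel σ α) := by
  have h : LocallyIntegrableOn
      (fun y => Real.exp |y| * (Real.exp (-1 * |y|) • kernel σ α y)) univ :=
    ((integrable_exp_neg_mul_kernel σ hα one_pos).locallyIntegrable.locallyIntegrableOn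
      univ).continuousOn_mul (by fun_prop) isOpen_univ.isLocallyClosed
  simpa [← mul_assoc, ← Real.exp_add, locallyIntegrableOn_univ] using h

theorem fourier_comp_units_smul {E : Type*} [NormedAddCommGroup E] [NormedSpace ℂ E] (f : ℝ → E)
    (η : ℝ) : 𝓕 (fun y => f (σ • y)) η = 𝓕 f (σ • η) := by
  rcases Int.units_eq_one_or σ with rfl | rfl
  · simp
  · simp [← Real.fourierInv_eq_fourier_neg, Real.fourierInv_eq_fourier_comp_neg]

theorem fourier_exp_neg_mul_kernel (hα : 0 < α) {ε : ℝ} (hε : 0 < ε) (η : ℝ) :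
    𝓕 (fun y => ((Real.exp (-ε * |y|) • kernel σ α y : ℝ) : ℂ)) η
      = (ε + 2 * Real.pi * Complex.I * (σ • η : ℝ)) ^ (-α : ℂ) := by
  have reflect : 𝓕 (fun y => ((Real.exp (-ε * |y|) • kernel σ α y : ℝ) : ℂ)) η
      = 𝓕 (fun y => ((Real.exp (-ε * |y|) • kernel 1 α y : ℝ) : ℂ)) (σ • η) := by
    rw [← fourier_comp_units_smul]
    rcases Int.units_eq_one_or σ with rfl | rfl <;> simp [kernel]
  rw [reflect]
  generalize σ • η = ξ
  have hz : 0 < (ε + 2 * Real.pi * Complex.I * ξ : ℂ).re := by simpa using hε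
  have hΓ : (Real.Gamma α : ℂ) ≠ 0 := by exact_mod_cast (Real.Gamma_pos_of_pos hα).ne'
  rw [← mul_div_cancel_right₀ ((_ : ℂ) ^ (-α : ℂ)) hΓ, ← integral_rpow_mul_cexp_neg_mul_Ioi hα hz,
    ← integral_div, Real.fourier_eq', ← integral_indicator measurableSet_Ioi]
  congr 1
  funext y
  by_cases hy : 0 < y
  · simp only [kernel, indicator, mem_Ioi, hy, one_smul, if_true, abs_of_pos hy, smul_eq_mul]
    have exp_split : Complex.exp (-(ε + 2 * Real.pi * Complex.I * ξ) * y)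
        = Complex.exp (((-2 * Real.pi * inner ℝ y ξ : ℝ) : ℂ) * Complex.I)
          * ((Real.exp (-ε * y) : ℝ) : ℂ) := by
      rw [Complex.ofReal_exp, ← Complex.exp_add]
      congr 1
      simp
      ring
    rw [exp_split]
    push_cast
    ring
  · simp [kernel, indicator, hy]

end Kernel

section Symbol

variable (σ : ℤˣ) (δ : ℝ)

theorem norm_two_pi_I_mul_units_smul (η : ℝ) :
    ‖2 * Real.pi * Complex.I * (σ • η : ℝ)‖ = 2 * Real.pi * |η| := by
  rcases Int.units_eq_one_or σ with rfl | rfl <;> simp [abs_of_pos Real.pi_pos]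

theorem norm_symbol (η : ℝ) : ‖symbol σ δ η‖ = (2 * Real.pi * |η|) ^ δ := by
  rw [symbol, Complex.norm_cpow_real, norm_two_pi_I_mul_units_smul]

@[fun_prop]
theorem measurable_symbol : Measurable (symbol σ δ) := by
  unfold symbol
  fun_prop

/-- The Fourier multiplier obtained from `symbol σ δ` by damping the kernel with `e^{-ε|y|}`. -/
noncomputable def dampedSymbol (ε η : ℝ) : ℂ :=
  (ε + 2 * Real.pi * Complex.I * (σ • η : ℝ)) ^ (-(order δ - δ : ℝ) : ℂ)
    * (2 * Real.pi * Complex.I * (σ • η : ℝ)) ^ order δ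

@[fun_prop]
theorem measurable_dampedSymbol (ε : ℝ) : Measurable (dampedSymbol σ δ ε) := by
  unfold dampedSymbol
  fun_prop

theorem norm_dampedSymbol_le (ε η : ℝ) : ‖dampedSymbol σ δ ε η‖ ≤ ‖symbol σ δ η‖ := by
  rw [norm_symbol, ← norm_two_pi_I_mul_units_smul σ, dampedSymbol]
  set z : ℂ := 2 * Real.pi * Complex.I * (σ • η : ℝ)
  rw [norm_mul, norm_pow, ← Complex.ofReal_neg, Complex.norm_cpow_real]
  rcases eq_or_ne z 0 with h0 | h0
  · simpa [h0, order] using Real.rpow_nonneg le_rfl δ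
  have norm_pos : 0 < ‖z‖ := norm_pos_iff.2 h0
  have norm_le : ‖z‖ ≤ ‖(ε : ℂ) + z‖ := by
    have abs_im : |z.im| = ‖z‖ := Complex.abs_im_eq_norm.2 (by simp [z])
    simpa [← abs_im] using Complex.abs_im_le_norm ((ε : ℂ) + z)
  calc ‖(ε : ℂ) + z‖ ^ (-(order δ - δ)) * ‖z‖ ^ order δ
      ≤ ‖z‖ ^ (-(order δ - δ)) * ‖z‖ ^ order δ := by
        gcongr ?_ * _
        exact Real.rpow_le_rpow_of_nonpos norm_pos norm_le (neg_nonpos.2 (order_sub_pos δ).le)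
    _ = ‖z‖ ^ δ := by
        rw [← Real.rpow_natCast ‖z‖ (order δ), ← Real.rpow_add norm_pos]
        congr 1
        ring

theorem tendsto_dampedSymbol {η : ℝ} (hη : η ≠ 0) :
    Tendsto (fun ε => dampedSymbol σ δ ε η) (𝓝[>] 0) (𝓝 (symbol σ δ η)) := by
  unfold dampedSymbol symbol
  set z : ℂ := 2 * Real.pi * Complex.I * (σ • η : ℝ)
  have him : z.im ≠ 0 := by
    rcases Int.units_eq_one_or σ with rfl | rfl <;> simp [z, Real.pi_ne_zero, hη]
  have hz : z ≠ 0 := fun h => him (by simp [h])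
  have split_symbol :
      z ^ (δ : ℂ) = ((0 : ℝ) + z : ℂ) ^ (-(order δ - δ : ℝ) : ℂ) * z ^ order δ := by
    rw [Complex.ofReal_zero, zero_add, ← Complex.cpow_natCast, ← Complex.cpow_add _ _ hz]
    congr 1
    push_cast
    ring
  have continuousAt_zero :
      ContinuousAt (fun ε : ℝ => ((ε : ℂ) + z) ^ (-(order δ - δ : ℝ) : ℂ)) 0 :=
    ContinuousAt.cpow (by fun_prop) continuousAt_const (Or.inr (by simpa using him))
  rw [split_symbol]
  exact (continuousAt_zero.tendsto.mul_const _).mono_left nhdsWithin_le_nhds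

theorem rpow_le_one_add_pow {x : ℝ} (hx : 0 ≤ x) {r : ℝ} (hr : 0 ≤ r) {n : ℕ} (hn : r ≤ n) :
    x ^ r ≤ 1 + x ^ n := by
  rcases le_total x 1 with h | h
  · exact (Real.rpow_le_one hx h hr).trans (le_add_of_nonneg_right (pow_nonneg hx n))
  · have := Real.rpow_le_rpow_of_exponent_le h hn
    rw [Real.rpow_natCast] at this
    exact this.trans (le_add_of_nonneg_left zero_le_one)

theorem memLp_symbol_mul_schwartz {δ : ℝ} (hδ : 0 ≤ δ) (g : 𝓢(ℝ, ℂ)) (p : ENNReal) :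
    MemLp (fun η => symbol σ δ η * g η) p := by
  obtain ⟨n, hn⟩ := exists_nat_ge δ
  have temperate : Function.HasTemperateGrowth (fun η : ℝ => ((2 * Real.pi * η : ℝ) : ℂ) ^ n) := by
    fun_prop
  set G := SchwartzMap.smulLeftCLM ℂ (fun η : ℝ => ((2 * Real.pi * η : ℝ) : ℂ) ^ n) g with hG
  have norm_G (η : ℝ) : ‖G η‖ = (2 * Real.pi * |η|) ^ n * ‖g η‖ := by
    rw [hG, SchwartzMap.smulLeftCLM_apply_apply temperate]
    simp [abs_of_pos Real.pi_pos]
  refine ((g.memLp p volume).norm.add (G.memLp p volume).norm).mono (by fun_prop)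
    (Eventually.of_forall fun η => ?_)
  calc ‖symbol σ δ η * g η‖ = (2 * Real.pi * |η|) ^ δ * ‖g η‖ := by rw [norm_mul, norm_symbol]
    _ ≤ (1 + (2 * Real.pi * |η|) ^ n) * ‖g η‖ := by
        gcongr
        exact rpow_le_one_add_pow (by positivity) hδ hn
    _ = ‖g η‖ + ‖G η‖ := by rw [norm_G]; ring
    _ ≤ ‖((fun η => ‖g η‖) + fun η => ‖G η‖) η‖ := Real.le_norm_self _

end Symbol

section RiemannLiouville

variable (σ : ℤˣ) {δ : ℝ}

section NormedSpace

variable {E F : Type*} [NormedAddCommGroup E] [NormedSpace ℝ E] [NormedAddCommGroup F]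
  [NormedSpace ℝ F] {φ : ℝ → E}

theorem lineRL_eq_smul_convolution (hφ : ContDiff ℝ (order δ) φ) (hφc : HasCompactSupport φ) :
    lineRL σ δ φ = σ ^ order δ •
      (kernel σ (order δ - δ) ⋆[ContinuousLinearMap.lsmul ℝ ℝ] iteratedDeriv (order δ) φ) := by
  rw [lineRL, iteratedDeriv_convolution _ (locallyIntegrable_kernel σ (order_sub_pos δ)) hφ hφc]

theorem lineRL_clm_comp [CompleteSpace E] [CompleteSpace F] (L : E →L[ℝ] F)
    (hφ : ContDiff ℝ (order δ) φ) (hφc : HasCompactSupport φ) :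
    lineRL σ δ (L ∘ φ) = L ∘ lineRL σ δ φ := by
  rw [lineRL_eq_smul_convolution σ (L.contDiff.comp hφ) (hφc.comp_left L.map_zero),
    lineRL_eq_smul_convolution σ hφ hφc, iteratedDeriv_clm_comp L hφ]
  funext s
  have conv_exists := (hasCompactSupport_iteratedDeriv (order δ) hφc).convolutionExists_right
    (ContinuousLinearMap.lsmul ℝ ℝ) (locallyIntegrable_kernel σ (order_sub_pos δ))
    (hφ.continuous_iteratedDeriv _ le_rfl) s
  have comp_conv := L.integral_comp_comm conv_exists
  simp only [ContinuousLinearMap.lsmul_apply, map_smul] at comp_conv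
  simp [convolution_def, Units.smul_def, comp_conv]

end NormedSpace

variable {φ : ℝ → ℂ}

theorem memLp_symbol_mul_fourier (hδ : 0 ≤ δ) (hφ : ContDiff ℝ ∞ φ) (hφc : HasCompactSupport φ)
    (p : ENNReal) : MemLp (fun η => symbol σ δ η * 𝓕 φ η) p := by
  have := memLp_symbol_mul_schwartz σ hδ (𝓕 (hφc.toSchwartzMap hφ)) p
  rwa [SchwartzMap.fourier_coe] at this

theorem memLp_fourier (hφ : ContDiff ℝ ∞ φ) (hφc : HasCompactSupport φ) (p : ENNReal) :
    MemLp (𝓕 φ) p := by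
  have := (𝓕 (hφc.toSchwartzMap hφ)).memLp p
  rwa [SchwartzMap.fourier_coe] at this

theorem integrable_dampedSymbol_mul_fourier (hδ : 0 ≤ δ) (hφ : ContDiff ℝ ∞ φ)
    (hφc : HasCompactSupport φ) (ε : ℝ) :
    Integrable (fun η => dampedSymbol σ δ ε η * 𝓕 φ η) := by
  refine (memLp_one_iff_integrable.1 (memLp_symbol_mul_fourier σ hδ hφ hφc 1)).mono
    ((measurable_dampedSymbol σ δ ε).aestronglyMeasurable.mul (memLp_fourier hφ hφc 1).1)
    (Eventually.of_forall fun η => ?_)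
  rw [norm_mul, norm_mul]
  exact mul_le_mul_of_nonneg_right (norm_dampedSymbol_le σ δ ε η) (norm_nonneg _)

theorem fourier_units_smul {E : Type*} [NormedAddCommGroup E] [NormedSpace ℂ E] (f : ℝ → E) :
    𝓕 (σ • f) = σ • 𝓕 f := by
  rcases Int.units_eq_one_or σ with rfl | rfl
  · simp
  · funext η
    simp [Real.fourier_eq, integral_neg]

theorem damped_convolution_eq_fourierInv (hδ : 0 ≤ δ) (hφ : ContDiff ℝ ∞ φ)
    (hφc : HasCompactSupport φ) {ε : ℝ} (hε : 0 < ε) :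
    σ ^ order δ • ((fun y => Real.exp (-ε * |y|) • kernel σ (order δ - δ) y)
        ⋆[ContinuousLinearMap.lsmul ℝ ℝ] iteratedDeriv (order δ) φ)
      = 𝓕⁻ (fun η => dampedSymbol σ δ ε η * 𝓕 φ η) := by
  set n := order δ with hn
  set k : ℝ → ℂ := fun y => ((Real.exp (-ε * |y|) • kernel σ (n - δ) y : ℝ) : ℂ)
  have hk : Integrable k := (integrable_exp_neg_mul_kernel σ (order_sub_pos δ) hε).ofReal
  have continuous_deriv (m : ℕ) : Continuous (iteratedDeriv m φ) :=
    hφ.continuous_iteratedDeriv m (by exact_mod_cast le_top)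
  have integrable_deriv (m : ℕ) : Integrable (iteratedDeriv m φ) :=
    (continuous_deriv m).integrable_of_hasCompactSupport (hasCompactSupport_iteratedDeriv m hφc)
  have fourier_conv : 𝓕 (σ ^ n • (k ⋆[ContinuousLinearMap.mul ℂ ℂ] iteratedDeriv n φ))
      = fun η => dampedSymbol σ δ ε η * 𝓕 φ η := by
    funext η
    rw [fourier_units_smul, Pi.smul_apply, Real.fourier_mul_convolution_eq hk (integrable_deriv n),
      fourier_exp_neg_mul_kernel σ (order_sub_pos δ) hε,
      Real.fourier_iteratedDeriv (N := ⊤) hφ (fun m _ => integrable_deriv m) le_top, dampedSymbol,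
      ← hn]
    simp [Units.smul_def, mul_pow]
    ring
  have integrable_conv :
      Integrable (σ ^ n • (k ⋆[ContinuousLinearMap.mul ℂ ℂ] iteratedDeriv n φ)) := by
    have := hk.integrable_convolution (ContinuousLinearMap.mul ℂ ℂ) (integrable_deriv n)
    rcases Int.units_eq_one_or (σ ^ n) with h | h <;> simpa [h] using this
  have continuous_conv :
      Continuous (σ ^ n • (k ⋆[ContinuousLinearMap.mul ℂ ℂ] iteratedDeriv n φ)) :=
    ((hasCompactSupport_iteratedDeriv n hφc).continuous_convolution_right _ hk.locallyIntegrable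
      (continuous_deriv n)).const_smul _
  rw [← fourier_conv, continuous_conv.fourierInv_fourier_eq integrable_conv
    (fourier_conv ▸ integrable_dampedSymbol_mul_fourier σ hδ hφ hφc ε)]
  rfl

theorem tendsto_fourierInv_dampedSymbol_mul (hδ : 0 ≤ δ) (hφ : ContDiff ℝ ∞ φ)
    (hφc : HasCompactSupport φ) (s : ℝ) :
    Tendsto (fun ε : ℝ => 𝓕⁻ (fun η => dampedSymbol σ δ ε η * 𝓕 φ η) s) (𝓝[>] 0)
      (𝓝 (𝓕⁻ (fun η => symbol σ δ η * 𝓕 φ η) s)) := by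
  simp only [Real.fourierInv_eq]
  refine tendsto_integral_filter_of_dominated_convergence
    (fun η => ‖symbol σ δ η * 𝓕 φ η‖) (Eventually.of_forall fun ε => ?_)
    (Eventually.of_forall fun ε => Eventually.of_forall fun η => ?_)
    (memLp_one_iff_integrable.1 (memLp_symbol_mul_fourier σ hδ hφ hφc 1)).norm ?_
  · have := (integrable_dampedSymbol_mul_fourier σ hδ hφ hφc ε).aestronglyMeasurable
    fun_prop
  · rw [Circle.norm_smul, norm_mul, norm_mul]
    exact mul_le_mul_of_nonneg_right (norm_dampedSymbol_le σ δ ε η) (norm_nonneg _)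
  · filter_upwards [compl_mem_ae_iff.2 (measure_singleton (0 : ℝ))] with η hη
    exact ((tendsto_dampedSymbol σ δ hη).mul_const _).const_smul _

theorem lineRL_eq_fourierInv (hδ : 0 ≤ δ) (hφ : ContDiff ℝ ∞ φ) (hφc : HasCompactSupport φ) :
    lineRL σ δ φ = 𝓕⁻ (fun η => symbol σ δ η * 𝓕 φ η) := by
  have hφn : ContDiff ℝ (order δ) φ := hφ.of_le (by exact_mod_cast le_top)
  funext s
  have damped_tendsto := (tendsto_convolution_exp_neg_mul (ContinuousLinearMap.lsmul ℝ ℝ)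
    (locallyIntegrable_kernel σ (order_sub_pos δ))
    (hφn.continuous_iteratedDeriv _ le_rfl)
    (hasCompactSupport_iteratedDeriv (order δ) hφc) s).const_smul (σ ^ order δ)
  rw [lineRL_eq_smul_convolution σ hφn hφc]
  refine tendsto_nhds_unique damped_tendsto
    ((tendsto_fourierInv_dampedSymbol_mul σ hδ hφ hφc s).congr' ?_)
  filter_upwards [self_mem_nhdsWithin] with ε hε
  rw [← damped_convolution_eq_fourierInv σ hδ hφ hφc hε, Pi.smul_apply]

end RiemannLiouville

section WeakDerivative

variable (σ : ℤˣ) {δ : ℝ}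

theorem conj_symbol_neg (δ η : ℝ) : conj (symbol (-σ) δ η) = symbol σ δ η := by
  have arg_ne_pi : (2 * Real.pi * Complex.I * (-σ • η : ℝ) : ℂ).arg ≠ Real.pi := fun h => by
    simpa using (Complex.arg_eq_pi_iff.1 h).1
  rw [symbol, symbol, ← Complex.conj_ofReal δ, ← Complex.conj_cpow _ _ arg_ne_pi,
    Complex.conj_ofReal]
  simp [map_ofNat]

section Test

variable {φ : ℝ → ℝ}

theorem contDiff_ofReal_comp (hφ : ContDiff ℝ ∞ φ) : ContDiff ℝ ∞ (fun s => (φ s : ℂ)) :=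
  Complex.ofRealCLM.contDiff.comp hφ

theorem hasCompactSupport_ofReal_comp (hφc : HasCompactSupport φ) :
    HasCompactSupport (fun s => (φ s : ℂ)) :=
  hφc.comp_left Complex.ofReal_zero

theorem ofReal_lineRL (hδ : 0 ≤ δ) (hφ : ContDiff ℝ ∞ φ) (hφc : HasCompactSupport φ) :
    (fun s => ((lineRL σ δ φ s : ℝ) : ℂ))
      = 𝓕⁻ (fun η => symbol σ δ η * 𝓕 (fun s => (φ s : ℂ)) η) := by
  rw [← lineRL_eq_fourierInv σ hδ (contDiff_ofReal_comp hφ) (hasCompactSupport_ofReal_comp hφc)]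
  exact (lineRL_clm_comp σ Complex.ofRealCLM (hφ.of_le (by exact_mod_cast le_top)) hφc).symm

theorem memLp_two_lineRL (hδ : 0 ≤ δ) (hφ : ContDiff ℝ ∞ φ) (hφc : HasCompactSupport φ) :
    MemLp (lineRL σ δ φ) 2 := by
  have memLp_symbol := memLp_symbol_mul_fourier σ hδ (contDiff_ofReal_comp hφ)
    (hasCompactSupport_ofReal_comp hφc)
  have := memLp_two_fourierInv (memLp_one_iff_integrable.1 (memLp_symbol 1)) (memLp_symbol 2)
  rw [← ofReal_lineRL σ hδ hφ hφc] at this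
  exact this.re

theorem integral_smul_eq_of_ofReal_eq_fourierInv {f : ℝ → ℝ} {m : ℝ → ℂ} (hm : Integrable m)
    (hm₂ : MemLp m 2) (hf : (fun s => (f s : ℂ)) = 𝓕⁻ m) (G : Lp ℂ 2 (volume : Measure ℝ)) :
    ∫ s, f s • G s = ∫ η, conj (m η) * (𝓕 G : Lp ℂ 2 (volume : Measure ℝ)) η := by
  have := integral_inner_fourierInv hm hm₂ G
  simp only [← hf] at this
  simpa [mul_comm] using this

theorem integral_test_smul (hφ : ContDiff ℝ ∞ φ) (hφc : HasCompactSupport φ)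
    (G : Lp ℂ 2 (volume : Measure ℝ)) :
    ∫ s, φ s • G s
      = ∫ η, conj (𝓕 (fun s => (φ s : ℂ)) η) * (𝓕 G : Lp ℂ 2 (volume : Measure ℝ)) η := by
  have hΦ := contDiff_ofReal_comp hφ
  have hΦc := hasCompactSupport_ofReal_comp hφc
  have integrable_fourier := memLp_one_iff_integrable.1 (memLp_fourier hΦ hΦc 1)
  exact integral_smul_eq_of_ofReal_eq_fourierInv integrable_fourier (memLp_fourier hΦ hΦc 2)
    (hΦ.continuous.fourierInv_fourier_eq (hΦ.continuous.integrable_of_hasCompactSupport hΦc)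
      integrable_fourier).symm G

theorem integral_lineRL_smul (hδ : 0 ≤ δ) (hφ : ContDiff ℝ ∞ φ) (hφc : HasCompactSupport φ)
    (F : Lp ℂ 2 (volume : Measure ℝ)) :
    ∫ s, lineRL (-σ) δ φ s • F s = ∫ η, conj (𝓕 (fun s => (φ s : ℂ)) η)
      * (symbol σ δ η * (𝓕 F : Lp ℂ 2 (volume : Measure ℝ)) η) := by
  have memLp_symbol := memLp_symbol_mul_fourier (-σ) hδ (contDiff_ofReal_comp hφ)
    (hasCompactSupport_ofReal_comp hφc)
  rw [integral_smul_eq_of_ofReal_eq_fourierInv (memLp_one_iff_integrable.1 (memLp_symbol 1))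
    (memLp_symbol 2) (ofReal_lineRL (-σ) hδ hφ hφc)]
  simp only [map_mul, conj_symbol_neg]
  congr 1 with η
  ring

theorem integrable_conj_fourier_mul (hφ : ContDiff ℝ ∞ φ) (hφc : HasCompactSupport φ)
    (G : Lp ℂ 2 (volume : Measure ℝ)) :
    Integrable (fun η => conj (𝓕 (fun s => (φ s : ℂ)) η) * G η) :=
  (memLp_fourier (contDiff_ofReal_comp hφ) (hasCompactSupport_ofReal_comp hφc)
    2).star.integrable_mul (Lp.memLp G)

theorem integrable_conj_fourier_mul_symbol_mul (hδ : 0 ≤ δ) (hφ : ContDiff ℝ ∞ φ)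
    (hφc : HasCompactSupport φ) (F : Lp ℂ 2 (volume : Measure ℝ)) :
    Integrable (fun η => conj (𝓕 (fun s => (φ s : ℂ)) η) * (symbol σ δ η * F η)) := by
  have := (memLp_symbol_mul_fourier (-σ) hδ (contDiff_ofReal_comp hφ)
    (hasCompactSupport_ofReal_comp hφc) 2).star.integrable_mul (Lp.memLp F)
  refine this.congr (Eventually.of_forall fun η => ?_)
  simp only [Pi.mul_apply, Pi.star_apply, RCLike.star_def, map_mul, conj_symbol_neg]
  ring

end Test

theorem exists_tests_fourier_tendsto_one : ∃ φ : ℕ → ℝ → ℝ,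
    (∀ n, ContDiff ℝ ∞ (φ n)) ∧ (∀ n, HasCompactSupport (φ n)) ∧
    ∀ η, Tendsto (fun n => 𝓕 (fun s => (φ n s : ℂ)) η) atTop (𝓝 1) := by
  let b : ℕ → ContDiffBump (0 : ℝ) := fun n =>
    ⟨1 / (2 * ((n : ℝ) + 1)), 1 / ((n : ℝ) + 1), by positivity, by
      have : (0 : ℝ) ≤ n := n.cast_nonneg
      exact one_div_lt_one_div_of_lt (by positivity) (by linarith)⟩
  refine ⟨fun n => (b n).normed volume, fun n => (b n).contDiff_normed,
    fun n => (b n).hasCompactSupport_normed, fun η => ?_⟩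
  have rOut_tendsto : Tendsto (fun n => (b n).rOut) atTop (𝓝 0) :=
    tendsto_one_div_add_atTop_nhds_zero_nat
  have conv_tendsto := ContDiffBump.convolution_tendsto_right_of_continuous (μ := volume)
    rOut_tendsto
    (g := fun t : ℝ => Complex.exp (((2 * Real.pi * (t * η) : ℝ) : ℂ) * Complex.I))
    (by fun_prop) 0
  simp only [zero_mul, mul_zero, Complex.ofReal_zero, Complex.exp_zero] at conv_tendsto
  refine conv_tendsto.congr fun n => ?_
  rw [Real.fourier_eq', convolution]
  congr 1 with s
  simp only [ContinuousLinearMap.lsmul_apply, Complex.real_smul, smul_eq_mul]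
  rw [mul_comm]
  congr 2
  simp
  ring

theorem fourier_comp_sub_right (f : ℝ → ℂ) (a η : ℝ) :
    𝓕 (fun s => f (s - a)) η
      = Complex.exp (((-2 * Real.pi * (a * η) : ℝ) : ℂ) * Complex.I) * 𝓕 f η := by
  rw [Real.fourier_eq', Real.fourier_eq', ← integral_const_mul, ← integral_add_right_eq_self _ a]
  congr 1 with s
  simp only [add_sub_cancel_right, smul_eq_mul, ← mul_assoc, ← Complex.exp_add]
  congr 2
  simp
  ring

theorem fourierInv_conj_fourier_mul (f g : ℝ → ℂ) (a : ℝ) :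
    𝓕⁻ (fun η => conj (𝓕 f η) * g η) a = ∫ η, conj (𝓕 (fun s => f (s - a)) η) * g η := by
  rw [Real.fourierInv_eq']
  congr 1 with η
  have conj_exp : conj (Complex.exp (((-2 * Real.pi * (a * η) : ℝ) : ℂ) * Complex.I))
      = Complex.exp (((2 * Real.pi * inner ℝ η a : ℝ) : ℂ) * Complex.I) := by
    rw [← Complex.exp_conj]
    simp [map_ofNat]
  rw [fourier_comp_sub_right, map_mul, conj_exp, smul_eq_mul]
  ring

-- Testing against the translates of `φ` shows that the inverse transform of `conj φ̂ * g` vanishes;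
-- then `φ` runs through an approximate identity.
theorem ae_eq_zero_of_integral_conj_fourier_mul_eq_zero {g : ℝ → ℂ}
    (hg : ∀ φ : ℝ → ℝ, ContDiff ℝ ∞ φ → HasCompactSupport φ →
      Integrable (fun η => conj (𝓕 (fun s => (φ s : ℂ)) η) * g η))
    (h : ∀ φ : ℝ → ℝ, ContDiff ℝ ∞ φ → HasCompactSupport φ →
      ∫ η, conj (𝓕 (fun s => (φ s : ℂ)) η) * g η = 0) : g =ᵐ[volume] 0 := by
  obtain ⟨φ, hφ, hφc, fourier_tendsto⟩ := exists_tests_fourier_tendsto_one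
  have product_zero : ∀ᵐ η, ∀ n, conj (𝓕 (fun s => (φ n s : ℂ)) η) * g η = 0 :=
    ae_all_iff.2 fun n => ae_eq_zero_of_fourierInv_eq_zero (hg _ (hφ n) (hφc n)) fun a => by
      rw [fourierInv_conj_fourier_mul (fun s => (φ n s : ℂ)) g]
      exact h (fun s => φ n (s - a)) ((hφ n).comp (contDiff_id.sub contDiff_const))
        ((hφc n).comp_homeomorph (Homeomorph.subRight a))
  filter_upwards [product_zero] with η hη
  have product_tendsto := ((Complex.continuous_conj.tendsto 1).comp
    (fourier_tendsto η)).mul_const (g η)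
  simp only [Function.comp_def, hη, map_one, one_mul] at product_tendsto
  exact tendsto_nhds_unique product_tendsto tendsto_const_nhds

/-- The function `g ∈ L²(ℝ)` is the weak Riemann–Liouville derivative of order `δ` of `f`, left for
`σ = 1` and right for `σ = -1`. The operator applied to the test function points the other way. -/
def IsLineDeriv {E : Type*} [NormedAddCommGroup E] [NormedSpace ℝ E] (σ : ℤˣ) (δ : ℝ)
    (f g : ℝ → E) : Prop :=
  MemLp g 2 ∧ ∀ φ : ℝ → ℝ, ContDiff ℝ ∞ φ → HasCompactSupport φ →
    ∫ s, φ s • g s = ∫ s, lineRL (-σ) δ φ s • f s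

variable {σ}

theorem IsLineDeriv.congr_ae {E : Type*} [NormedAddCommGroup E] [NormedSpace ℝ E]
    {f₁ f₂ g₁ g₂ : ℝ → E} (h : IsLineDeriv σ δ f₁ g₁) (hf : f₁ =ᵐ[volume] f₂)
    (hg : g₁ =ᵐ[volume] g₂) : IsLineDeriv σ δ f₂ g₂ := by
  refine ⟨h.1.ae_eq hg, fun φ hφ hφc => ?_⟩
  rw [← integral_congr_ae (hg.mono fun s hs => congrArg (φ s • ·) hs), h.2 φ hφ hφc]
  exact integral_congr_ae (hf.mono fun s hs => congrArg (lineRL (-σ) δ φ s • ·) hs)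

theorem IsLineDeriv.clm_comp {E F : Type*} [NormedAddCommGroup E] [NormedSpace ℝ E]
    [CompleteSpace E] [NormedAddCommGroup F] [NormedSpace ℝ F] [CompleteSpace F] (hδ : 0 ≤ δ)
    {f g : ℝ → E} (h : IsLineDeriv σ δ f g) (hf : MemLp f 2) (L : E →L[ℝ] F) :
    IsLineDeriv σ δ (L ∘ f) (L ∘ g) := by
  refine ⟨L.comp_memLp' h.1, fun φ hφ hφc => ?_⟩
  have integral_left := L.integral_comp_comm (memLp_one_iff_integrable.1
    (h.1.smul (hφ.continuous.memLp_of_hasCompactSupport (p := 2) hφc)))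
  have integral_right := L.integral_comp_comm (memLp_one_iff_integrable.1
    (hf.smul (memLp_two_lineRL (-σ) hδ hφ hφc)))
  simp only [Pi.smul_apply', map_smul] at integral_left integral_right
  simp only [Function.comp_apply, integral_left, integral_right, h.2 φ hφ hφc]

theorem isLineDeriv_iff_fourier_ae_eq (hδ : 0 ≤ δ) {F G : Lp ℂ 2 (volume : Measure ℝ)} :
    IsLineDeriv σ δ F G ↔ (𝓕 G : Lp ℂ 2 (volume : Measure ℝ)) =ᵐ[volume]
      fun η => symbol σ δ η * (𝓕 F : Lp ℂ 2 (volume : Measure ℝ)) η := by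
  refine ⟨fun h => ?_, fun h => ⟨Lp.memLp G, fun φ hφ hφc => ?_⟩⟩
  · refine (sub_ae_eq_zero _ _).1 (ae_eq_zero_of_integral_conj_fourier_mul_eq_zero
      (fun φ hφ hφc => ?_) fun φ hφ hφc => ?_)
    · simp only [Pi.sub_apply, mul_sub]
      exact (integrable_conj_fourier_mul hφ hφc (𝓕 G)).sub
        (integrable_conj_fourier_mul_symbol_mul σ hδ hφ hφc (𝓕 F))
    · simp only [Pi.sub_apply, mul_sub]
      rw [integral_sub (integrable_conj_fourier_mul hφ hφc _)
        (integrable_conj_fourier_mul_symbol_mul σ hδ hφ hφc _), ← integral_test_smul hφ hφc,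
        ← integral_lineRL_smul σ hδ hφ hφc, h.2 φ hφ hφc, sub_self]
  · rw [integral_test_smul hφ hφc, integral_lineRL_smul σ hδ hφ hφc]
    exact integral_congr_ae (h.mono fun η hη => by simp only [hη])

theorem memLp_ofReal_comp {f : ℝ → ℝ} {p : ENNReal} (hf : MemLp f p) :
    MemLp (fun s => (f s : ℂ)) p :=
  hf.ofReal

/-- The `L²` Fourier transform, in Mathlib's normalisation, of a real square-integrable function. -/
noncomputable def realFourier {f : ℝ → ℝ} (hf : MemLp f 2) : Lp ℂ 2 (volume : Measure ℝ) :=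
  𝓕 ((memLp_ofReal_comp hf).toLp (fun s => (f s : ℂ)))

variable {f g : ℝ → ℝ}

theorem IsLineDeriv.realFourier_ae_eq (hδ : 0 ≤ δ) (hf : MemLp f 2) (h : IsLineDeriv σ δ f g) :
    realFourier h.1 =ᵐ[volume] fun η => symbol σ δ η * realFourier hf η :=
  (isLineDeriv_iff_fourier_ae_eq hδ).1 <| (h.clm_comp hδ hf Complex.ofRealCLM).congr_ae
    (memLp_ofReal_comp hf).coeFn_toLp.symm (memLp_ofReal_comp h.1).coeFn_toLp.symm

theorem exists_isLineDeriv_iff (hδ : 0 ≤ δ) (hf : MemLp f 2) :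
    (∃ g, IsLineDeriv σ δ f g) ↔ MemLp (fun η => symbol σ δ η * realFourier hf η) 2 := by
  refine ⟨fun ⟨g, h⟩ => (Lp.memLp _).ae_eq (h.realFourier_ae_eq hδ hf), fun h => ?_⟩
  set F : Lp ℂ 2 (volume : Measure ℝ) := (memLp_ofReal_comp hf).toLp (fun s => (f s : ℂ))
  set G : Lp ℂ 2 (volume : Measure ℝ) := 𝓕⁻ (h.toLp _)
  have complex_deriv : IsLineDeriv σ δ F G := by
    rw [isLineDeriv_iff_fourier_ae_eq hδ, FourierTransform.fourier_fourierInv_eq]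
    exact h.coeFn_toLp
  refine ⟨_, (complex_deriv.clm_comp hδ (Lp.memLp F) Complex.reCLM).congr_ae ?_ EventuallyEq.rfl⟩
  exact (memLp_ofReal_comp hf).coeFn_toLp.mono fun s hs => by simp [F, hs]

theorem ofReal_integral_mul (hf : MemLp f 2) (hg : MemLp g 2) :
    ((∫ s, f s * g s : ℝ) : ℂ) = ∫ η, conj (realFourier hf η) * realFourier hg η := by
  have plancherel := Lp.inner_fourier_eq ((memLp_ofReal_comp hf).toLp (fun s => (f s : ℂ)))
    ((memLp_ofReal_comp hg).toLp (fun s => (g s : ℂ)))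
  rw [L2.inner_def, L2.inner_def] at plancherel
  calc ((∫ s, f s * g s : ℝ) : ℂ) = ∫ s, (f s * g s : ℂ) := by
        simp only [← Complex.ofReal_mul, integral_complex_ofReal]
    _ = _ := integral_congr_ae ?_
    _ = _ := plancherel.symm
    _ = ∫ η, conj (realFourier hf η) * realFourier hg η := by simp [realFourier, mul_comm]
  filter_upwards [(memLp_ofReal_comp hf).coeFn_toLp, (memLp_ofReal_comp hg).coeFn_toLp]
    with s hfs hgs
  rw [hfs, hgs]
  simp [mul_comm]

theorem integral_mul_eq_integral_re (hf : MemLp f 2) (hg : MemLp g 2) :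
    ∫ s, f s * g s = ∫ η, (conj (realFourier hf η) * realFourier hg η).re := by
  have integrable_product : Integrable (fun η => conj (realFourier hf η) * realFourier hg η) :=
    (Lp.memLp (realFourier hf)).star.integrable_mul (Lp.memLp (realFourier hg))
  rw [← Complex.ofReal_re (∫ s, f s * g s), ofReal_integral_mul hf hg]
  exact (integral_re integrable_product).symm

end WeakDerivative

section Energy

variable {f g h : ℝ → ℝ} {δ : ℝ}

/-- The integral `∫ (2π|η|)^{2δ} |f̂(η)|² dη`, which is `‖D^δ f‖²` for the left and for the right
derivative `D^δ`. -/
noncomputable def energy (hf : MemLp f 2) (δ : ℝ) : ℝ :=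
  ∫ η, ((2 * Real.pi * |η|) ^ δ * ‖realFourier hf η‖) ^ 2

theorem energy_nonneg (hf : MemLp f 2) (δ : ℝ) : 0 ≤ energy hf δ :=
  integral_nonneg fun _ => sq_nonneg _

theorem IsLineDeriv.integral_mul {σ τ : ℤˣ} (hδ : 0 ≤ δ) (hf : MemLp f 2)
    (hg : IsLineDeriv σ δ f g) (hh : IsLineDeriv τ δ f h) : ∫ s, g s * h s
      = ∫ η, (conj (symbol σ δ η) * symbol τ δ η).re * ‖realFourier hf η‖ ^ 2 := by
  rw [integral_mul_eq_integral_re hg.1 hh.1]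
  refine integral_congr_ae ?_
  filter_upwards [hg.realFourier_ae_eq hδ hf, hh.realFourier_ae_eq hδ hf] with η hgη hhη
  rw [hgη, hhη, ← Complex.re_mul_ofReal, map_mul, mul_mul_mul_comm, Complex.conj_mul',
    Complex.ofReal_pow]

theorem IsLineDeriv.integral_sq {σ : ℤˣ} (hδ : 0 ≤ δ) (hf : MemLp f 2)
    (hg : IsLineDeriv σ δ f g) : ∫ s, g s * g s = energy hf δ := by
  rw [hg.integral_mul hδ hf hg, energy]
  simp only [Complex.conj_mul', norm_symbol, ← Complex.ofReal_pow, Complex.ofReal_re, mul_pow]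

theorem re_symbol_sq (δ η : ℝ) :
    (symbol 1 δ η ^ 2).re = Real.cos (Real.pi * δ) * ((2 * Real.pi * |η|) ^ δ) ^ 2 := by
  set z : ℂ := 2 * Real.pi * Complex.I * ((1 : ℤˣ) • η : ℝ) with hz
  have norm_z : ‖z‖ = 2 * Real.pi * |η| := norm_two_pi_I_mul_units_smul 1 η
  have re_sq : (symbol 1 δ η ^ 2).re = Real.cos (2 * (z.arg * δ)) * (‖z‖ ^ δ) ^ 2 := by
    rw [symbol, ← hz, sq, Complex.mul_re, Complex.cpow_ofReal_re, Complex.cpow_ofReal_im,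
      Real.cos_two_mul']
    ring
  rw [re_sq, ← norm_z]
  have re_z : z.re = 0 := by simp [z]
  have im_z : z.im = 2 * Real.pi * η := by simp [z]
  rcases lt_trichotomy η 0 with hη | rfl | hη
  · have im_neg : z.im < 0 := im_z ▸ mul_neg_of_pos_of_neg Real.two_pi_pos hη
    rw [Complex.arg_eq_neg_pi_div_two_iff.2 ⟨re_z, im_neg⟩, ← Real.cos_neg]
    congr 2
    ring
  · rcases eq_or_ne δ 0 with rfl | hδ
    · simp
    · simp [z, Real.zero_rpow hδ]
  · have im_pos : 0 < z.im := im_z ▸ mul_pos Real.two_pi_pos hη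
    rw [Complex.arg_eq_pi_div_two_iff.2 ⟨re_z, im_pos⟩]
    congr 2
    ring

theorem IsLineDeriv.integral_left_mul_right (hδ : 0 ≤ δ) (hf : MemLp f 2)
    (hg : IsLineDeriv 1 δ f g) (hh : IsLineDeriv (-1) δ f h) :
    ∫ s, g s * h s = Real.cos (Real.pi * δ) * energy hf δ := by
  simp_rw [mul_comm (g _)]
  rw [hh.integral_mul hδ hf hg, energy, ← integral_const_mul]
  simp only [conj_symbol_neg, ← sq, re_symbol_sq, mul_pow, mul_assoc]

theorem cos_pi_mul_ne_zero (hδ : 0 ≤ δ) (hδn : ∀ n : ℕ, δ ≠ (n : ℝ) - 1 / 2) :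
    Real.cos (Real.pi * δ) ≠ 0 := by
  intro h
  obtain ⟨k, hk⟩ := Real.cos_eq_zero_iff.1 h
  have eq_add_half : δ = k + 1 / 2 :=
    mul_left_cancel₀ Real.pi_ne_zero (by linear_combination hk)
  have k_nonneg : 0 ≤ k := by
    have : (-1 : ℝ) < k := by linarith
    have : -1 < k := by exact_mod_cast this
    lia
  lift k to ℕ using k_nonneg
  refine hδn (k + 1) ?_
  push_cast at eq_add_half ⊢
  linarith

theorem memLp_comp_mul_left_iff {E : Type*} [NormedAddCommGroup E] {c : ℝ} (hc : c ≠ 0)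
    {u : ℝ → E} {p : ENNReal} : MemLp (fun x => u (c * x)) p ↔ MemLp u p := by
  rw [← Function.comp_def, ← (measurableEmbedding_mulLeft₀ hc).memLp_map_measure_iff]
  refine ⟨fun h => ?_, fun h => ?_⟩
  · rw [← Real.smul_map_volume_mul_left hc]
    exact h.smul_measure ENNReal.ofReal_ne_top
  · rw [Real.map_volume_mul_left hc]
    exact h.smul_measure ENNReal.ofReal_ne_top

theorem fourierL2_ofReal (hf : MemLp f 2) (ξ : ℝ) :
    fourierL2 (fun s => (f s : ℂ)) ξ = realFourier hf (ξ / (2 * Real.pi)) := by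
  rw [fourierL2, dif_pos (memLp_ofReal_comp hf)]
  rfl

theorem memLp_weight_mul_fourierL2_iff (σ : ℤˣ) (hf : MemLp f 2) :
    MemLp (fun ξ : ℝ => ((1 + |ξ| ^ δ : ℝ) : ℂ) * fourierL2 (fun s => (f s : ℂ)) ξ) 2 ↔
      MemLp (fun η => symbol σ δ η * realFourier hf η) 2 := by
  have two_pi_ne_zero := Real.two_pi_pos.ne'
  have hF := Lp.memLp (realFourier hf)
  rw [← memLp_comp_mul_left_iff two_pi_ne_zero]
  simp only [fourierL2_ofReal hf, mul_div_cancel_left₀ _ two_pi_ne_zero, abs_mul,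
    abs_of_pos Real.two_pi_pos]
  have norm_weight (η : ℝ) : ‖((1 + (2 * Real.pi * |η|) ^ δ : ℝ) : ℂ)‖ = 1 + ‖symbol σ δ η‖ := by
    rw [norm_symbol, Complex.norm_real, Real.norm_of_nonneg (by positivity)]
  refine ⟨fun h => h.mono (by fun_prop) (Eventually.of_forall fun η => ?_),
    fun h => (hF.norm.add h.norm).mono (by fun_prop) (Eventually.of_forall fun η => ?_)⟩
  · rw [norm_mul, norm_mul, norm_weight]
    gcongr
    linarith
  · rw [Pi.add_apply, norm_mul, norm_weight, norm_mul, Real.norm_of_nonneg (by positivity)]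
    exact (one_add_mul _ _).le

theorem integral_rpow_mul_norm_fourierL2_sq (hf : MemLp f 2) (δ : ℝ) :
    ∫ ξ : ℝ, (|ξ| ^ δ * ‖fourierL2 (fun s => (f s : ℂ)) ξ‖) ^ 2 = 2 * Real.pi * energy hf δ := by
  have scaling := Measure.integral_comp_div
    (fun η => ((2 * Real.pi * |η|) ^ δ * ‖realFourier hf η‖) ^ 2) (2 * Real.pi)
  rw [abs_of_pos Real.two_pi_pos, smul_eq_mul] at scaling
  rw [energy, ← scaling]
  simp only [fourierL2_ofReal hf, abs_div, abs_of_pos Real.two_pi_pos,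
    mul_div_cancel₀ _ Real.two_pi_pos.ne']

end Energy

theorem quasiMeasurePreserving_of_leftInverse {E : Type*} [NormedAddCommGroup E]
    [NormedSpace ℝ E] [FiniteDimensional ℝ E] [MeasurableSpace E] [BorelSpace E] (μ : Measure E)
    [μ.IsAddHaarMeasure] {f g : E → E} (hf : Continuous f) (hg : Differentiable ℝ g)
    (hgf : Function.LeftInverse g f) : Measure.QuasiMeasurePreserving f μ μ := by
  refine ⟨hf.measurable, Measure.AbsolutelyContinuous.mk fun s hs null => ?_⟩
  rw [Measure.map_apply hf.measurable hs]
  exact measure_mono_null (fun x (hx : f x ∈ s) => (⟨f x, hx, hgf x⟩ : x ∈ g '' s))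
    (addHaar_image_eq_zero_of_differentiableOn_of_addHaar_eq_zero μ hg.differentiableOn null)

namespace IsScaling

variable {ψ : ℝ → ℝ}

theorem deriv_pos (hψ : IsScaling ψ) (t : ℝ) : 0 < deriv ψ t :=
  hψ.strictMono.monotone.deriv_nonneg.lt_of_ne' (hψ.deriv_ne_zero t)

theorem surjective (hψ : IsScaling ψ) : Function.Surjective ψ :=
  hψ.differentiable.continuous.surjective hψ.tendsto_atTop hψ.tendsto_atBot

theorem leftInverse_invFun (hψ : IsScaling ψ) : Function.LeftInverse (Function.invFun ψ) ψ :=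
  Function.leftInverse_invFun hψ.strictMono.injective

theorem rightInverse_invFun (hψ : IsScaling ψ) : Function.RightInverse (Function.invFun ψ) ψ :=
  Function.rightInverse_invFun hψ.surjective

theorem pull_apply (hψ : IsScaling ψ) (v : ℝ → ℝ) (t : ℝ) : pull ψ v (ψ t) = v t := by
  rw [pull, hψ.leftInverse_invFun]

theorem pull_comp_self (hψ : IsScaling ψ) (v : ℝ → ℝ) : pull ψ v ∘ ψ = v :=
  funext (hψ.pull_apply v)

theorem pull_comp (hψ : IsScaling ψ) (f : ℝ → ℝ) : pull ψ (f ∘ ψ) = f :=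
  funext fun s => congrArg f (hψ.rightInverse_invFun s)

theorem continuous_invFun (hψ : IsScaling ψ) : Continuous (Function.invFun ψ) := by
  have invFun_eq_symm : Function.invFun ψ
      = (hψ.strictMono.orderIsoOfSurjective ψ hψ.surjective).symm :=
    funext fun s => ((OrderIso.symm_apply_eq _).2 (hψ.rightInverse_invFun s).symm).symm
  rw [invFun_eq_symm]
  exact OrderIso.continuous _

theorem differentiable_invFun (hψ : IsScaling ψ) : Differentiable ℝ (Function.invFun ψ) := fun _ =>
  (HasDerivAt.of_local_left_inverse hψ.continuous_invFun.continuousAt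
    (hψ.differentiable _).hasDerivAt (hψ.deriv_ne_zero _)
    (Eventually.of_forall hψ.rightInverse_invFun)).differentiableAt

theorem integral_comp_mul_deriv (hψ : IsScaling ψ) (f : ℝ → ℝ) :
    ∫ t, f (ψ t) * deriv ψ t = ∫ s, f s := by
  have change_of_variables := integral_image_eq_integral_abs_deriv_smul MeasurableSet.univ
    (fun t _ => (hψ.differentiable t).hasDerivAt.hasDerivWithinAt)
    hψ.strictMono.injective.injOn f
  simpa only [image_univ, hψ.surjective.range_eq, Measure.restrict_univ,
    abs_of_pos (hψ.deriv_pos _), smul_eq_mul, mul_comm] using change_of_variables.symm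

theorem integrable_comp_mul_deriv_iff (hψ : IsScaling ψ) (f : ℝ → ℝ) :
    Integrable (fun t => f (ψ t) * deriv ψ t) ↔ Integrable f := by
  have change_of_variables := integrableOn_image_iff_integrableOn_abs_deriv_smul MeasurableSet.univ
    (fun t _ => (hψ.differentiable t).hasDerivAt.hasDerivWithinAt)
    hψ.strictMono.injective.injOn f
  simpa only [image_univ, hψ.surjective.range_eq, integrableOn_univ, abs_of_pos (hψ.deriv_pos _),
    smul_eq_mul, mul_comm] using change_of_variables.symm

theorem aestronglyMeasurable_pull_iff (hψ : IsScaling ψ) {v : ℝ → ℝ} :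
    AEStronglyMeasurable (pull ψ v) ↔ AEStronglyMeasurable v := by
  refine ⟨fun h => ?_, fun h => h.comp_quasiMeasurePreserving
    (quasiMeasurePreserving_of_leftInverse volume hψ.continuous_invFun hψ.differentiable
      hψ.rightInverse_invFun)⟩
  have := h.comp_quasiMeasurePreserving (quasiMeasurePreserving_of_leftInverse volume
    hψ.differentiable.continuous hψ.differentiable_invFun hψ.leftInverse_invFun)
  rwa [hψ.pull_comp_self] at this

theorem memL2_iff (hψ : IsScaling ψ) {v : ℝ → ℝ} : MemL2 ψ v ↔ MemLp (pull ψ v) 2 := by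
  have integrable_sq_iff : Integrable (fun t => |v t| ^ 2 * deriv ψ t) ↔
      Integrable (fun s => pull ψ v s ^ 2) := by
    rw [← hψ.integrable_comp_mul_deriv_iff (fun s => pull ψ v s ^ 2)]
    simp only [hψ.pull_apply, sq_abs]
  rw [MemL2, integrable_sq_iff, ← hψ.aestronglyMeasurable_pull_iff]
  exact ⟨fun h => (memLp_two_iff_integrable_sq h.1).2 h.2,
    fun h => ⟨h.1, (memLp_two_iff_integrable_sq h.1).1 h⟩⟩

theorem inner2_eq (hψ : IsScaling ψ) (v w : ℝ → ℝ) :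
    inner2 ψ v w = ∫ s, pull ψ v s * pull ψ w s := by
  rw [← hψ.integral_comp_mul_deriv]
  simp only [hψ.pull_apply, inner2]

theorem scaledDeriv_comp (hψ : IsScaling ψ) (f : ℝ → ℝ) :
    scaledDeriv ψ (f ∘ ψ) = deriv f ∘ ψ := by
  funext t
  rw [scaledDeriv, Function.comp_apply, one_div_mul_eq_div, div_eq_iff (hψ.deriv_ne_zero t)]
  by_cases hf : DifferentiableAt ℝ f (ψ t)
  · exact deriv_comp t hf (hψ.differentiable t)
  · have not_differentiableAt_comp : ¬DifferentiableAt ℝ (f ∘ ψ) t := fun h => hf <| by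
      rw [← hψ.leftInverse_invFun t] at h
      rw [← hψ.pull_comp f]
      exact h.comp (ψ t) (hψ.differentiable_invFun (ψ t))
    rw [deriv_zero_of_not_differentiableAt hf, zero_mul,
      deriv_zero_of_not_differentiableAt not_differentiableAt_comp]

theorem iterate_units_smul_scaledDeriv_comp (hψ : IsScaling ψ) (σ : ℤˣ) (n : ℕ) (f : ℝ → ℝ) :
    (fun u => σ • scaledDeriv ψ u)^[n] (f ∘ ψ) = (σ ^ n • iteratedDeriv n f) ∘ ψ := by
  induction n with
  | zero => simp
  | succ n ih =>
    have deriv_units_smul (τ : ℤˣ) (u : ℝ → ℝ) : deriv (τ • u) = τ • deriv u := by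
      rcases Int.units_eq_one_or τ with rfl | rfl
      · simp
      · ext
        simp
    rw [Function.iterate_succ_apply', ih, hψ.scaledDeriv_comp, deriv_units_smul,
      ← iteratedDeriv_succ, pow_succ', mul_smul]
    rfl

theorem kernel_convolution_pull_apply (hψ : IsScaling ψ) (σ : ℤˣ) (α : ℝ) (w : ℝ → ℝ) (t : ℝ) :
    (kernel σ α ⋆[ContinuousLinearMap.lsmul ℝ ℝ] pull ψ w) (ψ t)
      = ∫ z, kernel σ α (ψ t - ψ z) * w z * deriv ψ z := by
  rw [convolution_lsmul_swap, ← hψ.integral_comp_mul_deriv]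
  simp only [hψ.pull_apply, smul_eq_mul]

theorem leftInt_eq (hψ : IsScaling ψ) (α : ℝ) (w : ℝ → ℝ) :
    leftInt ψ α w = (kernel 1 α ⋆[ContinuousLinearMap.lsmul ℝ ℝ] pull ψ w) ∘ ψ := by
  funext t
  rw [Function.comp_apply, hψ.kernel_convolution_pull_apply, leftInt, ← integral_const_mul,
    ← integral_indicator measurableSet_Iio]
  congr 1 with z
  simp only [kernel, indicator, mem_Iio, mem_Ioi, one_smul, sub_pos, hψ.strictMono.lt_iff_lt]
  split_ifs <;> ring

theorem rightInt_eq (hψ : IsScaling ψ) (α : ℝ) (w : ℝ → ℝ) :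
    rightInt ψ α w = (kernel (-1) α ⋆[ContinuousLinearMap.lsmul ℝ ℝ] pull ψ w) ∘ ψ := by
  funext t
  rw [Function.comp_apply, hψ.kernel_convolution_pull_apply, rightInt, ← integral_const_mul,
    ← integral_indicator measurableSet_Ioi]
  congr 1 with z
  simp only [kernel, indicator, mem_Ioi, Units.neg_smul, one_smul, neg_sub, sub_pos,
    hψ.strictMono.lt_iff_lt]
  split_ifs <;> ring

theorem leftRL_eq (hψ : IsScaling ψ) (δ : ℝ) (w : ℝ → ℝ) :
    leftRL ψ δ w = lineRL 1 δ (pull ψ w) ∘ ψ := by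
  have := hψ.iterate_units_smul_scaledDeriv_comp 1 (order δ)
    (kernel 1 (order δ - δ) ⋆[ContinuousLinearMap.lsmul ℝ ℝ] pull ψ w)
  simp only [one_smul] at this
  rw [leftRL, hψ.leftInt_eq, lineRL]
  simpa only [one_smul, one_pow] using this

theorem rightRL_eq (hψ : IsScaling ψ) (δ : ℝ) (w : ℝ → ℝ) :
    rightRL ψ δ w = lineRL (-1) δ (pull ψ w) ∘ ψ := by
  have := hψ.iterate_units_smul_scaledDeriv_comp (-1) (order δ)
    (kernel (-1) (order δ - δ) ⋆[ContinuousLinearMap.lsmul ℝ ℝ] pull ψ w)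
  rw [rightRL, hψ.rightInt_eq, lineRL, ← this]
  simp only [Units.neg_smul, one_smul]
  rfl

theorem forall_isTest_iff (hψ : IsScaling ψ) {P : (ℝ → ℝ) → Prop} :
    (∀ w, IsTest ψ w → P (pull ψ w)) ↔ ∀ φ, ContDiff ℝ ∞ φ → HasCompactSupport φ → P φ := by
  refine ⟨fun h φ hφ hφc => ?_, fun h w hw => h _ hw.1 hw.2⟩
  have isTest_comp : IsTest ψ (φ ∘ ψ) := by
    rw [IsTest, hψ.pull_comp]
    exact ⟨hφ, hφc⟩
  simpa only [hψ.pull_comp] using h _ isTest_comp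

theorem isLeftDeriv_iff (hψ : IsScaling ψ) {δ : ℝ} {v g : ℝ → ℝ} :
    IsLeftDeriv ψ δ v g ↔ IsLineDeriv 1 δ (pull ψ v) (pull ψ g) := by
  simp only [IsLeftDeriv, IsLineDeriv, hψ.memL2_iff, hψ.inner2_eq, hψ.rightRL_eq, hψ.pull_comp,
    ← hψ.forall_isTest_iff, smul_eq_mul, mul_comm]

theorem isRightDeriv_iff (hψ : IsScaling ψ) {δ : ℝ} {v g : ℝ → ℝ} :
    IsRightDeriv ψ δ v g ↔ IsLineDeriv (-1) δ (pull ψ v) (pull ψ g) := by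
  simp only [IsRightDeriv, IsLineDeriv, hψ.memL2_iff, hψ.inner2_eq, hψ.leftRL_eq, hψ.pull_comp,
    ← hψ.forall_isTest_iff, smul_eq_mul, mul_comm, neg_neg]

end IsScaling

theorem sqrt_energy_pull_eq {ψ v : ℝ → ℝ} (hf : MemLp (pull ψ v) 2) (δ : ℝ) :
    √(energy hf δ) = (√(2 * Real.pi))⁻¹ * fourierSemi ψ δ v := by
  simp only [fourierSemi, fourierPull, integral_rpow_mul_norm_fourierL2_sq hf]
  rw [Real.sqrt_mul Real.two_pi_pos.le,
    inv_mul_cancel_left₀ (Real.sqrt_ne_zero'.2 Real.two_pi_pos)]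

namespace IsScaling

variable {ψ v g : ℝ → ℝ} {δ : ℝ}

theorem exists_isLineDeriv_pull_iff (hψ : IsScaling ψ) (hδ : 0 ≤ δ) (σ : ℤˣ) (hv : MemL2 ψ v) :
    (∃ g, IsLineDeriv σ δ (pull ψ v) (pull ψ g)) ↔ v ∈ fourierSpace ψ δ := by
  have hf := hψ.memL2_iff.1 hv
  have exists_pull_iff : (∃ g, IsLineDeriv σ δ (pull ψ v) (pull ψ g)) ↔
      ∃ f, IsLineDeriv σ δ (pull ψ v) f :=
    ⟨fun ⟨g, hg⟩ => ⟨_, hg⟩, fun ⟨f, hf⟩ => ⟨f ∘ ψ, by rwa [hψ.pull_comp]⟩⟩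
  rw [exists_pull_iff, exists_isLineDeriv_iff hδ hf, ← memLp_weight_mul_fourierL2_iff σ hf]
  exact (and_iff_right hv).symm

theorem exists_isLeftDeriv_iff (hψ : IsScaling ψ) (hδ : 0 ≤ δ) (hv : MemL2 ψ v) :
    (∃ g, IsLeftDeriv ψ δ v g) ↔ v ∈ fourierSpace ψ δ := by
  simp only [hψ.isLeftDeriv_iff, hψ.exists_isLineDeriv_pull_iff hδ 1 hv]

theorem exists_isRightDeriv_iff (hψ : IsScaling ψ) (hδ : 0 ≤ δ) (hv : MemL2 ψ v) :
    (∃ g, IsRightDeriv ψ δ v g) ↔ v ∈ fourierSpace ψ δ := by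
  simp only [hψ.isRightDeriv_iff, hψ.exists_isLineDeriv_pull_iff hδ (-1) hv]

theorem leftSpace_eq (hψ : IsScaling ψ) (hδ : 0 ≤ δ) : leftSpace ψ δ = fourierSpace ψ δ :=
  Set.ext fun _ => ⟨fun h => (hψ.exists_isLeftDeriv_iff hδ h.1).1 h.2,
    fun h => ⟨h.1, (hψ.exists_isLeftDeriv_iff hδ h.1).2 h⟩⟩

theorem rightSpace_eq (hψ : IsScaling ψ) (hδ : 0 ≤ δ) : rightSpace ψ δ = fourierSpace ψ δ :=
  Set.ext fun _ => ⟨fun h => (hψ.exists_isRightDeriv_iff hδ h.1).1 h.2,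
    fun h => ⟨h.1, (hψ.exists_isRightDeriv_iff hδ h.1).2 h⟩⟩

theorem mixedSpace_eq (hψ : IsScaling ψ) (hδ : 0 ≤ δ) : mixedSpace ψ δ = fourierSpace ψ δ :=
  Set.ext fun _ => ⟨fun h => (hψ.exists_isLeftDeriv_iff hδ h.1).1 h.2.1,
    fun h => ⟨h.1, (hψ.exists_isLeftDeriv_iff hδ h.1).2 h,
      (hψ.exists_isRightDeriv_iff hδ h.1).2 h⟩⟩

theorem isLineDeriv_leftD (hψ : IsScaling ψ) (hδ : 0 ≤ δ) (hv : v ∈ fourierSpace ψ δ) :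
    IsLineDeriv 1 δ (pull ψ v) (pull ψ (leftD ψ δ v)) := by
  have exists_deriv := (hψ.exists_isLeftDeriv_iff hδ hv.1).2 hv
  rw [← hψ.isLeftDeriv_iff, leftD, dif_pos exists_deriv]
  exact exists_deriv.choose_spec

theorem isLineDeriv_rightD (hψ : IsScaling ψ) (hδ : 0 ≤ δ) (hv : v ∈ fourierSpace ψ δ) :
    IsLineDeriv (-1) δ (pull ψ v) (pull ψ (rightD ψ δ v)) := by
  have exists_deriv := (hψ.exists_isRightDeriv_iff hδ hv.1).2 hv
  rw [← hψ.isRightDeriv_iff, rightD, dif_pos exists_deriv]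
  exact exists_deriv.choose_spec

theorem leftSemi_eq (hψ : IsScaling ψ) (hδ : 0 ≤ δ) (hv : v ∈ fourierSpace ψ δ) :
    leftSemi ψ δ v = (√(2 * Real.pi))⁻¹ * fourierSemi ψ δ v := by
  have hf := hψ.memL2_iff.1 hv.1
  rw [leftSemi, norm2, hψ.inner2_eq, (hψ.isLineDeriv_leftD hδ hv).integral_sq hδ hf,
    sqrt_energy_pull_eq]

theorem rightSemi_eq (hψ : IsScaling ψ) (hδ : 0 ≤ δ) (hv : v ∈ fourierSpace ψ δ) :
    rightSemi ψ δ v = (√(2 * Real.pi))⁻¹ * fourierSemi ψ δ v := by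
  have hf := hψ.memL2_iff.1 hv.1
  rw [rightSemi, norm2, hψ.inner2_eq, (hψ.isLineDeriv_rightD hδ hv).integral_sq hδ hf,
    sqrt_energy_pull_eq]

theorem mixedSemi_eq (hψ : IsScaling ψ) (hδ : 0 ≤ δ) (hv : v ∈ fourierSpace ψ δ) :
    mixedSemi ψ δ v
      = √|Real.cos (Real.pi * δ)| * (√(2 * Real.pi))⁻¹ * fourierSemi ψ δ v := by
  have hf := hψ.memL2_iff.1 hv.1
  rw [mixedSemi, hψ.inner2_eq, (hψ.isLineDeriv_leftD hδ hv).integral_left_mul_right hδ hf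
    (hψ.isLineDeriv_rightD hδ hv), abs_mul, abs_of_nonneg (energy_nonneg hf δ),
    Real.sqrt_mul (abs_nonneg _), sqrt_energy_pull_eq, mul_assoc]

end IsScaling

theorem sqrt_sq_add_mul_sq_bounds {c k a : ℝ} (hc : 0 ≤ c) (hck : c ≤ k) (hk : k ≤ 1) (ha : 0 ≤ a)
    (n : ℝ) : c * √(n ^ 2 + a ^ 2) ≤ √(n ^ 2 + (k * a) ^ 2) ∧
      √(n ^ 2 + (k * a) ^ 2) ≤ 1 * √(n ^ 2 + a ^ 2) := by
  constructor
  · rw [← Real.sqrt_sq hc, ← Real.sqrt_mul (sq_nonneg c), mul_add, ← mul_pow c a]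
    gcongr
    exact mul_le_of_le_one_left (sq_nonneg n) (pow_le_one₀ hc (hck.trans hk))
  · rw [one_mul]
    have := hc.trans hck
    gcongr
    exact mul_le_of_le_one_left ha hk

end PsiFrac

theorem lemma2 (δ : ℝ) (hδ : 0 < δ) (hδn : ∀ n : ℕ, δ ≠ (n : ℝ) - 1 / 2) :
    ∃ c C : ℝ, 0 < c ∧ 0 < C ∧ ∀ ψ : ℝ → ℝ, PsiFrac.IsScaling ψ →
      (PsiFrac.leftSpace ψ δ = PsiFrac.fourierSpace ψ δ ∧
        PsiFrac.rightSpace ψ δ = PsiFrac.fourierSpace ψ δ ∧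
        PsiFrac.mixedSpace ψ δ = PsiFrac.fourierSpace ψ δ) ∧
      ∀ v ∈ PsiFrac.fourierSpace ψ δ,
        (c * PsiFrac.fourierSemi ψ δ v ≤ PsiFrac.leftSemi ψ δ v ∧
          PsiFrac.leftSemi ψ δ v ≤ C * PsiFrac.fourierSemi ψ δ v) ∧
        (c * PsiFrac.fourierSemi ψ δ v ≤ PsiFrac.rightSemi ψ δ v ∧
          PsiFrac.rightSemi ψ δ v ≤ C * PsiFrac.fourierSemi ψ δ v) ∧
        (c * PsiFrac.fourierSemi ψ δ v ≤ PsiFrac.mixedSemi ψ δ v ∧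
          PsiFrac.mixedSemi ψ δ v ≤ C * PsiFrac.fourierSemi ψ δ v) ∧
        (c * PsiFrac.fourierNorm ψ δ v ≤ PsiFrac.leftNorm ψ δ v ∧
          PsiFrac.leftNorm ψ δ v ≤ C * PsiFrac.fourierNorm ψ δ v) ∧
        (c * PsiFrac.fourierNorm ψ δ v ≤ PsiFrac.rightNorm ψ δ v ∧
          PsiFrac.rightNorm ψ δ v ≤ C * PsiFrac.fourierNorm ψ δ v) ∧
        (c * PsiFrac.fourierNorm ψ δ v ≤ PsiFrac.mixedNorm ψ δ v ∧
          PsiFrac.mixedNorm ψ δ v ≤ C * PsiFrac.fourierNorm ψ δ v) := by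
  set k : ℝ := (√(2 * Real.pi))⁻¹
  set c : ℝ := √|Real.cos (Real.pi * δ)| * k
  have k_pos : 0 < k := inv_pos.2 (Real.sqrt_pos.2 Real.two_pi_pos)
  have k_le_one : k ≤ 1 :=
    inv_le_one_of_one_le₀ (Real.one_le_sqrt.2 (by linarith [Real.two_le_pi]))
  have c_pos : 0 < c :=
    mul_pos (Real.sqrt_pos.2 (abs_pos.2 (PsiFrac.cos_pi_mul_ne_zero hδ.le hδn))) k_pos
  have c_le_k : c ≤ k := mul_le_of_le_one_left k_pos.le
    (Real.sqrt_le_one.2 (Real.abs_cos_le_one _))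
  refine ⟨c, 1, c_pos, one_pos, fun ψ hψ =>
    ⟨⟨hψ.leftSpace_eq hδ.le, hψ.rightSpace_eq hδ.le, hψ.mixedSpace_eq hδ.le⟩, fun v hv => ?_⟩⟩
  have semi_nonneg : 0 ≤ PsiFrac.fourierSemi ψ δ v := Real.sqrt_nonneg _
  have semi_bounds {r : ℝ} (hcr : c ≤ r) (hr : r ≤ 1) :=
    And.intro (mul_le_mul_of_nonneg_right hcr semi_nonneg)
      (mul_le_mul_of_nonneg_right hr semi_nonneg)
  have norm_bounds {r : ℝ} (hcr : c ≤ r) (hr : r ≤ 1) :=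
    PsiFrac.sqrt_sq_add_mul_sq_bounds c_pos.le hcr hr semi_nonneg (PsiFrac.norm2 ψ v)
  rw [PsiFrac.leftNorm, PsiFrac.rightNorm, PsiFrac.mixedNorm, PsiFrac.fourierNorm,
    hψ.leftSemi_eq hδ.le hv, hψ.rightSemi_eq hδ.le hv, hψ.mixedSemi_eq hδ.le hv]
  have c_le_one := c_le_k.trans k_le_one
  exact ⟨semi_bounds c_le_k k_le_one, semi_bounds c_le_k k_le_one, semi_bounds le_rfl c_le_one,
    norm_bounds c_le_k k_le_one, norm_bounds c_le_k k_le_one, norm_bounds le_rfl c_le_one⟩
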